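/- Let $n,m,f,d,r,s_e$ be nonnegative integers with $d\le f$ and $s_e\ge 1$. Let $M=L+DS$ with $L\in\mathbb R^{f\times nm}$ of rank $r$, $D\in\mathbb R^{f\times d}$, and $S\in\mathbb R^{d\times nm}$ having at most $s_e$ nonzero entries. Let $L=U\Sigma V^\top$ be a compact singular value decomposition, $P_U=UU^\top$, $P_V=VV^\top$, and $\mathcal P_{\mathcal L}(Z)=P_UZ+ZP_V-P_UZP_V$. Define $$\mu=\max_{Z}\frac{\|\mathcal P_{\mathcal L}(Z)\|_F}{\|Z\|_F},$$ where $Z$ runs over the nonzero matrices $DH$ such that $H\in\mathbb R^{d\times nm}$ vanishes wherever $S$ does ($\mu=0$ if there are none), and $$\gamma_U=\max_i\frac{\|P_UDe_i\|^2}{\|De_i\|^2},\qquad \gamma_V=\max_i\|P_Ve_i\|^2,\qquad \xi_e=\max_{i,j}|(D^\top UV^\top)_{ij}| .$$ Suppose that $D$ satisfies the generalized frame property with bounds $0<\alpha_\ell\le\alpha_u<\infty$, that is, $\alpha_\ell\|v\|^2\le\|Dv\|^2\le\alpha_u\|v\|^2$ for all $v\in\mathbb R^d$, and that $\alpha_\ell\le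 1/(1-\mu)^2$. Suppose that $s_e\le\frac{(1-\mu)^2}{2}\frac{nm}{r}$ (no condition if $r=0$) and that $$\gamma_U\le\begin{cases}\dfrac{(1-\mu)^2-2s_e\gamma_V}{2s_e(1+\gamma_V)}, & s_e\le d,\\[2ex]\dfrac{(1-\mu)^2-2s_e\gamma_V}{2(d+s_e\gamma_V)}, & s_e>d.\end{cases}$$ Let $$c=\tfrac{\alpha_u}{2}\big((1+2\gamma_U)(\min(s_e,d)+s_e\gamma_V)+2\gamma_V\min(s_e,nm)\big)-\tfrac{\alpha_\ell}{2}\big(\min(s_e,d)+s_e\gamma_V\big),$$ $$C_e=\frac{c}{\alpha_\ell(1-\mu)^2-c},\qquad \lambda_e^{\min}=\frac{1+C_e}{1-C_e}\,\xi_e,\qquad \lambda_e^{\max}=\frac{\sqrt{\alpha_\ell}\,(1-\mu)-\sqrt{r\alpha_u}\,\mu}{\sqrt{s_e}},$$ and suppose that $C_e$ is well defined (its denominator is nonzero), that $0\le C_e<1$, and that $\lambda_e^{\min}<\lambda_e^{\max}$. Then for every $\lambda_e\in[\lambda_e^{\min},\lambda_e^{\max}]$ the pair $(L,S)$ is an optimal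 solution of the convex program $$\min_{X,Y}\ \|X\|_*+\lambda_e\|Y\|_1\quad\text{subject to}\quad M=X+DY$$ ($\|\cdot\|_*$ the nuclear norm, $\|\cdot\|_1$ the entrywise $\ell_1$ norm), and it is the unique optimal solution, so that the program exactly recovers $L$ and $S$, except possibly when both $\lambda_e=\lambda_e^{\max}$ and $\mu=0$. -/

import Mathlib

open scoped Matrix

noncomputable section

namespace DRPCA

variable {p q d : Type*} [Fintype p] [Fintype q] [Fintype d]
  [DecidableEq p] [DecidableEq q] [DecidableEq d]

/-- The nuclear norm: the sum of the singular values of `X` (as an operator between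
Euclidean spaces). -/
def nuclearNorm (X : Matrix p q ℝ) : ℝ :=
  ∑ i ∈ Finset.range (Fintype.card q), (Matrix.toEuclideanLin X).singularValues i

/-- The entry-wise `ℓ¹` norm. -/
def l1Norm (X : Matrix p q ℝ) : ℝ := ∑ i, ∑ j, |X i j|

/-- The number of nonzero entries, `‖X‖₀`. -/
def numNonzeros (X : Matrix p q ℝ) : ℕ := {k : p × q | X k.1 k.2 ≠ 0}.ncard

/-- The Euclidean norm of a vector. -/
def vecNorm (v : p → ℝ) : ℝ := ‖WithLp.toLp 2 v‖

/-- The generalized frame property of `D` on the whole coefficient space, with frame bounds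
`αl` and `αu`. -/
structure GeneralizedFrame (D : Matrix p d ℝ) (αl αu : ℝ) : Prop where
  pos : 0 < αl
  le : αl ≤ αu
  lower : ∀ v : d → ℝ, v ≠ 0 → αl * vecNorm v ^ 2 ≤ vecNorm (D *ᵥ v) ^ 2
  upper : ∀ v : d → ℝ, v ≠ 0 → vecNorm (D *ᵥ v) ^ 2 ≤ αu * vecNorm v ^ 2

/-- `L = U Σ Vᵀ` is a compact singular value decomposition: `U` and `V` have orthonormal
columns and `Σ = diag σ` has positive diagonal entries in descending order. -/
structure IsCompactSVD {r : ℕ} (L : Matrix p q ℝ)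
    (U : Matrix p (Fin r) ℝ) (σ : Fin r → ℝ) (V : Matrix q (Fin r) ℝ) : Prop where
  orthU : Uᵀ * U = 1
  orthV : Vᵀ * V = 1
  pos : ∀ i, 0 < σ i
  anti : Antitone σ
  eq : L = U * Matrix.diagonal σ * Vᵀ

/-- The operator `𝒫_𝓛 Z = P_U Z + Z P_V - P_U Z P_V`, where `P_U = U Uᵀ` and `P_V = V Vᵀ`. -/
def projL {r : ℕ} (U : Matrix p (Fin r) ℝ) (V : Matrix q (Fin r) ℝ) (Z : Matrix p q ℝ) :
    Matrix p q ℝ :=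
  (U * Uᵀ) * Z + Z * (V * Vᵀ) - (U * Uᵀ) * Z * (V * Vᵀ)

/-- The space `𝓢_e` of coefficient matrices supported on the support of `S`. -/
def supportSpace (S : Matrix d q ℝ) : Set (Matrix d q ℝ) :=
  {H | ∀ i j, S i j = 0 → H i j = 0}

/-- The space `𝓓 = {D H : H ∈ 𝓢_e}`. -/
def dictSpace (D : Matrix p d ℝ) (S : Matrix d q ℝ) : Set (Matrix p q ℝ) :=
  {Z | ∃ H ∈ supportSpace S, Z = D * H}

section
open scoped Matrix.Norms.Frobenius

/-- The incoherence `μ = max_{Z ∈ 𝓓 \ {0}} ‖𝒫_𝓛 Z‖_F / ‖Z‖_F` (Frobenius norms; it is `0` when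
`𝓓 = {0}`). -/
def incoherence {r : ℕ} (U : Matrix p (Fin r) ℝ) (V : Matrix q (Fin r) ℝ)
    (D : Matrix p d ℝ) (S : Matrix d q ℝ) : ℝ :=
  sSup {t : ℝ | ∃ Z ∈ dictSpace D S, Z ≠ 0 ∧ t = ‖projL U V Z‖ / ‖Z‖}

end

/-- `γ_U = max_i ‖P_U D e_i‖² / ‖D e_i‖²`. -/
def gammaU {r : ℕ} (U : Matrix p (Fin r) ℝ) (D : Matrix p d ℝ) : ℝ :=
  ⨆ i : d, vecNorm ((U * Uᵀ) *ᵥ (D *ᵥ Pi.single i 1)) ^ 2 / vecNorm (D *ᵥ Pi.single i 1) ^ 2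

/-- `γ_V = max_i ‖P_V e_i‖²`. -/
def gammaV {r : ℕ} (V : Matrix q (Fin r) ℝ) : ℝ :=
  ⨆ i : q, vecNorm ((V * Vᵀ) *ᵥ Pi.single i 1) ^ 2

/-- `ξ_e = ‖Dᵀ U Vᵀ‖_∞`, the largest absolute value of an entry. -/
def xiE {r : ℕ} (U : Matrix p (Fin r) ℝ) (V : Matrix q (Fin r) ℝ) (D : Matrix p d ℝ) : ℝ :=
  ⨆ k : d × q, |(Dᵀ * U * Vᵀ) k.1 k.2|

/-- The constant `c`; here `dd` is the number of dictionary elements and `N` the number of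
columns of the data. -/
def cConst (αl αu γU γV : ℝ) (se dd N : ℕ) : ℝ :=
  αu / 2 * ((1 + 2 * γU) * (min (se : ℝ) dd + se * γV) + 2 * γV * min (se : ℝ) N)
    - αl / 2 * (min (se : ℝ) dd + se * γV)

/-- The denominator `α_ℓ (1 - μ)² - c` of `C_e`. -/
def ceDenom (αl αu γU γV : ℝ) (se dd N : ℕ) (μ : ℝ) : ℝ :=
  αl * (1 - μ) ^ 2 - cConst αl αu γU γV se dd N

/-- `C_e = c / (α_ℓ (1 - μ)² - c)`. -/
def ceConst (αl αu γU γV : ℝ) (se dd N : ℕ) (μ : ℝ) : ℝ :=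
  cConst αl αu γU γV se dd N / ceDenom αl αu γU γV se dd N μ

/-- `λ_e^min = (1 + C_e) / (1 - C_e) * ξ_e`. -/
def lamMin (Ce ξ : ℝ) : ℝ := (1 + Ce) / (1 - Ce) * ξ

/-- `λ_e^max = (√α_ℓ (1 - μ) - √(r α_u) μ) / √s_e`. -/
def lamMax (αl αu μ : ℝ) (r se : ℕ) : ℝ :=
  (√αl * (1 - μ) - √(r * αu) * μ) / √(se : ℝ)

/-- The feasible set of D-RPCA(E): pairs `(X, Y)` with `M = X + D Y`. -/
def feasible (D : Matrix p d ℝ) (M : Matrix p q ℝ) : Set (Matrix p q ℝ × Matrix d q ℝ) :=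
  {x | M = x.1 + D * x.2}

/-- The objective `‖X‖_* + λ ‖Y‖₁` of D-RPCA(E). -/
def objective (lam : ℝ) (x : Matrix p q ℝ × Matrix d q ℝ) : ℝ :=
  nuclearNorm x.1 + lam * l1Norm x.2

/-- The set of optimal solutions of D-RPCA(E). -/
def solutions (D : Matrix p d ℝ) (M : Matrix p q ℝ) (lam : ℝ) :
    Set (Matrix p q ℝ × Matrix d q ℝ) :=
  {x | x ∈ feasible D M ∧ IsMinOn (objective lam) (feasible D M) x}

end DRPCA

end

open DRPCA

/-! Every feasible point has the form $(L-DH,\,S+H)$, so optimality follows from a dual certificate: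
a matrix $W=UV^\top+Q$, with $Q$ in the range of $Z\mapsto(1-P_U)Z(1-P_V)$ and $\|Q\|_F\le1$, such
that $D^\top W$ equals $\lambda\,\mathrm{sign}(S)$ on the support $\Omega$ of $S$ and is bounded by
$\lambda$ off it. Then $W$ is a contraction with $\langle W,L\rangle=\|L\|_*$, so the nuclear norm
drops by at most $\langle W,DH\rangle$, while $\lambda\|\cdot\|_1$ grows by at least $\langle D^\top
W,H\rangle$, the same number (`objective_le_of_certificate`).

The certificate (`exists_certificate`) is the least-squares one, $Q=(1-P_U)DX(1-P_V)$ with $X$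
supported on $\Omega$. The sign condition becomes a linear system for $X\mapsto AXB$ restricted to
$\Omega$, with $A=D^\top(1-P_U)D$ and $B=1-P_V$. Its diagonal entries are at least
$\alpha_\ell(1-\mu)^2$ and its off-diagonal row sums at most $c$. Diagonal dominance thus gives
solvability and $\|X\|_\infty\le(\lambda+\xi_e)/(\alpha_\ell(1-\mu)^2-c)$, so off $\Omega$ the
entries of $D^\top W$ are at most $\xi_e+C_e(\lambda+\xi_e)$, which is at most $\lambda$ exactly
when $\lambda\ge\lambda_e^{\min}$. Pairing the system with $X$ bounds $\|Q\|_F^2$ by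
$(1-\mu)/(1+\mu)$ when $\lambda\le\lambda_e^{\max}$.

Strict forms of both bounds give uniqueness: a second minimiser has $H$ supported on $\Omega$ and
$(1-P_U)DH(1-P_V)=0$; then $\mu<1$ gives $DH=0$ and the frame bound gives $H=0$. The case
$\lambda=0$, where no strict bound off $\Omega$ exists, is separate: it forces $U^\top D=0$, and
`eq_zero_of_nuclearNorm_sub_le` applies. -/

namespace DRPCA

/-! ### The nuclear norm: duality with the operator norm, and its value on a compact SVD -/

section NuclearNorm

variable {p q d : Type*} [Fintype p] [Fintype q] [Fintype d]

/-- The Frobenius inner product of two real matrices. -/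
def frob (A B : Matrix p q ℝ) : ℝ := ∑ i, ∑ j, A i j * B i j

variable [DecidableEq q]

/-- The pairing is the trace of $W^*X$, hence independent of the orthonormal basis; this allows it
to be evaluated in a basis of singular vectors. -/
lemma frob_eq_sum_inner {ι : Type*} [Fintype ι] (W X : Matrix p q ℝ)
    (b : OrthonormalBasis ι ℝ (EuclideanSpace ℝ q)) :
    frob W X = ∑ i, inner ℝ (Matrix.toEuclideanLin W (b i)) (Matrix.toEuclideanLin X (b i)) := by
  have key : ∀ {κ : Type _} [Fintype κ] (b : OrthonormalBasis κ ℝ (EuclideanSpace ℝ q)),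
      ∑ i, inner ℝ (Matrix.toEuclideanLin W (b i)) (Matrix.toEuclideanLin X (b i)) =
      LinearMap.trace ℝ _
        (LinearMap.adjoint (Matrix.toEuclideanLin W) ∘ₗ Matrix.toEuclideanLin X) := by
    intro κ _ b
    classical
    rw [LinearMap.trace_eq_sum_inner _ b]
    simp [LinearMap.adjoint_inner_right]
  rw [key b]
  classical
  rw [LinearMap.trace_eq_sum_inner _ (EuclideanSpace.basisFun q ℝ)]
  simp only [LinearMap.comp_apply, LinearMap.adjoint_inner_right]
  rw [frob, Finset.sum_comm]
  refine Finset.sum_congr rfl fun j _ => ?_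
  simp [PiLp.inner_apply, Matrix.toEuclideanLin, mul_comm]

/-- An eigenbasis of $X^*X$ serves: the images are orthogonal, and their lengths are the square
roots of the eigenvalues. -/
lemma exists_singular_basis (X : Matrix p q ℝ) :
    ∃ b : OrthonormalBasis (Fin (Fintype.card q)) ℝ (EuclideanSpace ℝ q),
      nuclearNorm X = ∑ i, ‖Matrix.toEuclideanLin X (b i)‖ ∧
      ∀ i j, i ≠ j →
        inner ℝ (Matrix.toEuclideanLin X (b i)) (Matrix.toEuclideanLin X (b j)) = 0 := by
  set T := Matrix.toEuclideanLin X with hT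
  have hn : Module.finrank ℝ (EuclideanSpace ℝ q) = Fintype.card q := by simp
  have hs := T.isSymmetric_adjoint_comp_self
  have inn : ∀ i j, inner ℝ (T (hs.eigenvectorBasis hn i)) (T (hs.eigenvectorBasis hn j)) =
      if i = j then hs.eigenvalues hn j else 0 := by
    intro i j
    have h := hs.apply_eigenvectorBasis hn j
    rw [← LinearMap.adjoint_inner_right, ← LinearMap.comp_apply, h, inner_smul_right,
      orthonormal_iff_ite.1 (hs.eigenvectorBasis hn).orthonormal]
    simp
  refine ⟨hs.eigenvectorBasis hn, ?_, fun i j hij => by rw [inn, if_neg hij]⟩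
  rw [nuclearNorm, Finset.sum_range]
  refine Finset.sum_congr rfl fun i _ => ?_
  rw [LinearMap.singularValues_fin _ hn, norm_eq_sqrt_real_inner, inn, if_pos rfl]

lemma norm_toEuclideanLin_sq (W : Matrix p q ℝ) (v : EuclideanSpace ℝ q) :
    ‖Matrix.toEuclideanLin W v‖ ^ 2 = (W *ᵥ v.ofLp) ⬝ᵥ (W *ᵥ v.ofLp) := by
  rw [EuclideanSpace.real_norm_sq_eq]
  simp [dotProduct, pow_two, Matrix.toEuclideanLin]

lemma frob_le_mul_nuclearNorm (W X : Matrix p q ℝ) (κ : ℝ) (hκ : 0 ≤ κ)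
    (hW : ∀ v, (W *ᵥ v) ⬝ᵥ (W *ᵥ v) ≤ κ ^ 2 * (v ⬝ᵥ v)) :
    frob W X ≤ κ * nuclearNorm X := by
  obtain ⟨b, hb, -⟩ := exists_singular_basis X
  rw [hb, frob_eq_sum_inner W X b, Finset.mul_sum]
  refine Finset.sum_le_sum fun i _ => (real_inner_le_norm _ _).trans ?_
  refine mul_le_mul_of_nonneg_right ?_ (norm_nonneg _)
  refine le_of_sq_le_sq ?_ hκ
  rw [norm_toEuclideanLin_sq]
  refine (hW _).trans_eq ?_
  have h : ‖b i‖ ^ 2 = 1 := by simp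
  rw [EuclideanSpace.real_norm_sq_eq] at h
  have : (b i).ofLp ⬝ᵥ (b i).ofLp = 1 := by
    rw [← h]; simp [dotProduct, pow_two]
  rw [this, mul_one]

/-- Bessel's inequality after normalisation. Some `u i` may vanish; since $0^{-1}=0$ they contribute
nothing. -/
lemma sum_inner_sq_le {ι E : Type*} [Fintype ι] [NormedAddCommGroup E] [InnerProductSpace ℝ E]
    (u : ι → E) (h : ∀ i j, i ≠ j → inner ℝ (u i) (u j) = 0) (x : E) :
    ∑ i, (inner ℝ (‖u i‖⁻¹ • u i) x) ^ 2 ≤ ‖x‖ ^ 2 := by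
  classical
  have ho : Orthonormal ℝ (fun i : {i // u i ≠ 0} => ‖u i‖⁻¹ • u i) := by
    refine ⟨fun i => ?_, fun i j hij => ?_⟩
    · have := norm_ne_zero_iff.2 i.2
      simp [norm_smul, this]
    · simp only
      rw [inner_smul_left, inner_smul_right, h _ _ (fun e => hij (Subtype.ext e))]; simp
  have hb := ho.sum_inner_products_le (x := x) (s := Finset.univ)
  refine le_trans (le_of_eq ?_) hb
  simp only [Real.norm_eq_abs, sq_abs]
  rw [← Finset.sum_subtype (p := fun i => u i ≠ 0) (Finset.univ.filter (fun i => u i ≠ 0))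
    (by simp) (fun i => (inner ℝ (‖u i‖⁻¹ • u i) x : ℝ) ^ 2)]
  refine (Finset.sum_filter_of_ne (p := fun i => u i ≠ 0) fun i _ hi hu => hi ?_).symm
  simp [hu]

/-- Expanding each $\|Lb_i\|$ along the SVD, the coefficient of $\sigma_k$ is $\sum_i\langle
v_k,b_i\rangle\langle\hat u_i,u_k\rangle$, where $\hat u_i$ is $Lb_i$ normalised. It is at most 1 by
$xy\le(x^2+y^2)/2$, Parseval for $v_k$ and Bessel for $u_k$. -/
lemma nuclearNorm_le_sum {r : ℕ} {L : Matrix p q ℝ}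
    {U : Matrix p (Fin r) ℝ} {σ : Fin r → ℝ} {V : Matrix q (Fin r) ℝ}
    (h : IsCompactSVD L U σ V) : nuclearNorm L ≤ ∑ k, σ k := by
  obtain ⟨b, hb, ho⟩ := exists_singular_basis L
  set T := Matrix.toEuclideanLin L with hT
  let u' : Fin r → EuclideanSpace ℝ p := fun k => WithLp.toLp 2 (fun i => U i k)
  let v' : Fin r → EuclideanSpace ℝ q := fun k => WithLp.toLp 2 (fun i => V i k)
  have hu' : ∀ k, ‖u' k‖ ^ 2 = 1 := fun k => by
    have := congrFun (congrFun h.orthU k) k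
    rw [EuclideanSpace.real_norm_sq_eq]
    simpa [u', Matrix.mul_apply, pow_two] using this
  have hv' : ∀ k, ‖v' k‖ ^ 2 = 1 := fun k => by
    have := congrFun (congrFun h.orthV k) k
    rw [EuclideanSpace.real_norm_sq_eq]
    simpa [v', Matrix.mul_apply, pow_two] using this
  have hTx : ∀ x, T x = ∑ k, (σ k * inner ℝ (v' k) x) • u' k := by
    intro x
    ext i
    rw [hT, h.eq, Matrix.toLpLin_apply, ← Matrix.mulVec_mulVec, ← Matrix.mulVec_mulVec]
    have hd : ∀ k, (Matrix.diagonal σ *ᵥ (Vᵀ *ᵥ x.ofLp)) k = σ k * inner ℝ (v' k) x := by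
      intro k
      rw [Matrix.mulVec_diagonal]
      simp [PiLp.inner_apply, Matrix.mulVec, dotProduct, mul_comm, v']
    simp only [← hd]
    generalize Matrix.diagonal σ *ᵥ (Vᵀ *ᵥ x.ofLp) = w
    simp [Matrix.mulVec, dotProduct, mul_comm, u']
  have hi : ∀ i, ‖T (b i)‖ =
      ∑ k, σ k * (inner ℝ (v' k) (b i) * inner ℝ (‖T (b i)‖⁻¹ • T (b i)) (u' k)) := by
    intro i
    have h1 : ‖T (b i)‖ = inner ℝ (‖T (b i)‖⁻¹ • T (b i)) (T (b i)) := by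
      rw [inner_smul_left, real_inner_self_eq_norm_mul_norm]
      by_cases h0 : ‖T (b i)‖ = 0
      · simp [h0]
      · simp [h0]
    refine h1.trans ?_
    have h4 := congrArg (fun z => (inner ℝ (‖T (b i)‖⁻¹ • T (b i)) z : ℝ)) (hTx (b i))
    refine h4.trans ?_
    rw [inner_sum]
    refine Finset.sum_congr rfl fun k _ => ?_
    rw [inner_smul_right, mul_assoc]
  rw [hb, Finset.sum_congr rfl fun i _ => hi i, Finset.sum_comm]
  refine Finset.sum_le_sum fun k _ => ?_
  rw [← Finset.mul_sum]
  refine mul_le_of_le_one_right (h.pos k).le ?_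
  have h1 := sum_inner_sq_le (fun i => T (b i)) ho (u' k)
  have h2 : ∑ i, (inner ℝ (v' k) (b i) : ℝ) ^ 2 = 1 := by
    rw [← hv' k, ← b.sum_sq_norm_inner_left]
    simp
  have h3 : ∑ i, (inner ℝ (v' k) (b i) * inner ℝ (‖T (b i)‖⁻¹ • T (b i)) (u' k) : ℝ) ≤
      ∑ i, ((inner ℝ (v' k) (b i) : ℝ) ^ 2 + (inner ℝ (‖T (b i)‖⁻¹ • T (b i)) (u' k)) ^ 2) / 2 :=
    Finset.sum_le_sum fun i _ => by
      nlinarith [sq_nonneg ((inner ℝ (v' k) (b i) : ℝ) - inner ℝ (‖T (b i)‖⁻¹ • T (b i)) (u' k))]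
  rw [← Finset.sum_div, Finset.sum_add_distrib, h2] at h3
  rw [hu'] at h1
  linarith

end NuclearNorm

/-! ### Algebra of the Frobenius inner product -/

section Frob
variable {p q d : Type*} [Fintype p] [Fintype q] [Fintype d]

lemma frob_eq_trace (A B : Matrix p q ℝ) : frob A B = (Aᵀ * B).trace := by
  rw [frob, Finset.sum_comm]
  simp [Matrix.trace, Matrix.mul_apply]

lemma frob_comm (A B : Matrix p q ℝ) : frob A B = frob B A := by
  simp [frob, mul_comm]

lemma frob_add_right (A B C : Matrix p q ℝ) : frob A (B + C) = frob A B + frob A C := by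
  simp [frob_eq_trace, Matrix.mul_add]

lemma frob_sub_right (A B C : Matrix p q ℝ) : frob A (B - C) = frob A B - frob A C := by
  simp [frob_eq_trace, Matrix.mul_sub]

lemma frob_smul_right (A B : Matrix p q ℝ) (t : ℝ) : frob A (t • B) = t * frob A B := by
  simp [frob_eq_trace]

lemma frob_add_left (A B C : Matrix p q ℝ) : frob (A + B) C = frob A C + frob B C := by
  simp [frob_comm _ C, frob_add_right]

lemma frob_sub_left (A B C : Matrix p q ℝ) : frob (A - B) C = frob A C - frob B C := by
  simp [frob_comm _ C, frob_sub_right]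

lemma frob_smul_left (A B : Matrix p q ℝ) (t : ℝ) : frob (t • A) B = t * frob A B := by
  simp [frob_comm _ B, frob_smul_right]

lemma frob_mul_left (A : Matrix p d ℝ) (X : Matrix d q ℝ) (Y : Matrix p q ℝ) :
    frob (A * X) Y = frob X (Aᵀ * Y) := by
  simp [frob_eq_trace, Matrix.mul_assoc]

lemma frob_mul_right (X : Matrix p d ℝ) (B : Matrix d q ℝ) (Y : Matrix p q ℝ) :
    frob (X * B) Y = frob X (Y * Bᵀ) := by
  rw [frob_eq_trace, frob_eq_trace, Matrix.transpose_mul, Matrix.mul_assoc, Matrix.trace_mul_comm,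
    Matrix.mul_assoc]

lemma frob_self_nonneg (A : Matrix p q ℝ) : 0 ≤ frob A A :=
  Finset.sum_nonneg fun _ _ => Finset.sum_nonneg fun _ _ => mul_self_nonneg _

lemma frob_self_eq_zero {A : Matrix p q ℝ} (h : frob A A = 0) : A = 0 := by
  have h' : ∑ k : p × q, A k.1 k.2 ^ 2 = 0 := by
    rw [Fintype.sum_prod_type]
    simpa only [frob, pow_two] using h
  rw [Finset.sum_eq_zero_iff_of_nonneg fun _ _ => sq_nonneg _] at h'
  ext i j
  simpa using h' (i, j) (Finset.mem_univ _)

lemma frob_sq_le (A B : Matrix p q ℝ) : frob A B ^ 2 ≤ frob A A * frob B B := by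
  simp only [frob, ← Finset.sum_product']
  simpa only [pow_two] using Finset.sum_mul_sq_le_sq_mul_sq (Finset.univ ×ˢ Finset.univ)
    (fun k : p × q => A k.1 k.2) (fun k => B k.1 k.2)

lemma abs_frob_le (A B : Matrix p q ℝ) : |frob A B| ≤ √(frob A A) * √(frob B B) := by
  rw [← Real.sqrt_mul (frob_self_nonneg A)]
  exact Real.abs_le_sqrt (frob_sq_le A B)

lemma mulVec_dotProduct_self_le (A : Matrix p q ℝ) (v : q → ℝ) :
    (A *ᵥ v) ⬝ᵥ (A *ᵥ v) ≤ frob A A * (v ⬝ᵥ v) := by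
  rw [frob, dotProduct, Finset.sum_mul]
  refine Finset.sum_le_sum fun i _ => ?_
  rw [← pow_two]
  simpa only [pow_two, dotProduct, Matrix.mulVec] using
    Finset.sum_mul_sq_le_sq_mul_sq Finset.univ (A i) v

lemma mulVec_dotProduct_mulVec (A : Matrix p q ℝ) (B : Matrix p d ℝ) (v : q → ℝ) (w : d → ℝ) :
    (A *ᵥ v) ⬝ᵥ (B *ᵥ w) = v ⬝ᵥ ((Aᵀ * B) *ᵥ w) := by
  rw [← Matrix.mulVec_mulVec, Matrix.dotProduct_mulVec v, Matrix.vecMul_transpose]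

lemma dotProduct_self_nonneg' (v : q → ℝ) : 0 ≤ v ⬝ᵥ v :=
  Finset.sum_nonneg fun _ _ => mul_self_nonneg _

lemma vecNorm_sq (v : q → ℝ) : vecNorm v ^ 2 = v ⬝ᵥ v := by
  rw [vecNorm, EuclideanSpace.real_norm_sq_eq]
  simp [dotProduct, pow_two]

open scoped Matrix.Norms.Frobenius in
lemma frobenius_norm_eq_sqrt (A : Matrix p q ℝ) : ‖A‖ = √(frob A A) := by
  rw [Matrix.frobenius_norm_def, Real.sqrt_eq_rpow]
  simp [frob, pow_two]

end Frob

/-! ### Pairings with $UV^\top$ for orthonormal $U$, $V$ -/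

section Isometry
variable {p q : Type*} [Fintype p] [Fintype q] {r : ℕ}
  {U : Matrix p (Fin r) ℝ} {V : Matrix q (Fin r) ℝ}

lemma frob_mul_transpose_self (hU : Uᵀ * U = 1) (hV : Vᵀ * V = 1) :
    frob (U * Vᵀ) (U * Vᵀ) = r := by
  rw [frob_mul_left, ← Matrix.mul_assoc, hU, Matrix.one_mul, frob_eq_trace]
  rw [Matrix.transpose_transpose, Matrix.trace_mul_comm, hV]
  simp

lemma frob_mul_transpose_eq_sum {L : Matrix p q ℝ} {σ : Fin r → ℝ} (h : IsCompactSVD L U σ V) :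
    frob (U * Vᵀ) L = ∑ k, σ k := by
  rw [frob_mul_left, h.eq, ← Matrix.mul_assoc, ← Matrix.mul_assoc, h.orthU, Matrix.one_mul,
    frob_comm, frob_mul_right]
  simp only [Matrix.transpose_transpose, h.orthV]
  rw [frob_eq_trace]
  simp [Matrix.trace]

lemma mulVec_transpose_dotProduct (hU : Uᵀ * U = 1) (v : q → ℝ) :
    ((U * Vᵀ) *ᵥ v) ⬝ᵥ ((U * Vᵀ) *ᵥ v) = (Vᵀ *ᵥ v) ⬝ᵥ (Vᵀ *ᵥ v) := by
  rw [← Matrix.mulVec_mulVec, mulVec_dotProduct_mulVec, hU, Matrix.one_mulVec]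

end Isometry

lemma transpose_one_sub {p : Type*} [DecidableEq p] {r : ℕ}
    (U : Matrix p (Fin r) ℝ) : (1 - U * Uᵀ)ᵀ = 1 - U * Uᵀ := by
  simp

/-! ### The complementary projection and contractions built from it -/

section Proj
variable {p q d : Type*} [Fintype p] [Fintype q] [Fintype d] [DecidableEq p] [DecidableEq q]
  {r : ℕ}

/-- The orthogonal projection `Z ↦ (1 - P_U) Z (1 - P_V)` onto the complement of the range of
`projL U V`. -/
def projPerp (U : Matrix p (Fin r) ℝ) (V : Matrix q (Fin r) ℝ) (Z : Matrix p q ℝ) :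
    Matrix p q ℝ :=
  (1 - U * Uᵀ) * Z * (1 - V * Vᵀ)

lemma transpose_mul_one_sub {U : Matrix p (Fin r) ℝ} (hU : Uᵀ * U = 1) :
    Uᵀ * (1 - U * Uᵀ) = 0 := by
  rw [Matrix.mul_sub, ← Matrix.mul_assoc, hU]; simp

lemma one_sub_mul_self {U : Matrix p (Fin r) ℝ} (hU : Uᵀ * U = 1) :
    (1 - U * Uᵀ) * (1 - U * Uᵀ) = 1 - U * Uᵀ := by
  rw [Matrix.sub_mul, Matrix.mul_assoc, transpose_mul_one_sub hU]; simp

variable {U : Matrix p (Fin r) ℝ} {V : Matrix q (Fin r) ℝ}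

lemma projL_eq_sub (U : Matrix p (Fin r) ℝ) (V : Matrix q (Fin r) ℝ) (Z : Matrix p q ℝ) :
    projL U V Z = Z - projPerp U V Z := by
  simp only [projL, projPerp, Matrix.sub_mul, Matrix.mul_sub, Matrix.one_mul, Matrix.mul_one]
  abel

lemma projPerp_idem (hU : Uᵀ * U = 1) (hV : Vᵀ * V = 1) (Z : Matrix p q ℝ) :
    projPerp U V (projPerp U V Z) = projPerp U V Z := by
  unfold projPerp
  calc _ = ((1 - U * Uᵀ) * (1 - U * Uᵀ)) * Z * ((1 - V * Vᵀ) * (1 - V * Vᵀ)) := by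
        simp only [Matrix.mul_assoc]
    _ = _ := by rw [one_sub_mul_self hU, one_sub_mul_self hV]

lemma frob_projPerp_left (X Y : Matrix p q ℝ) :
    frob (projPerp U V X) Y = frob X (projPerp U V Y) := by
  unfold projPerp
  rw [frob_mul_right, frob_mul_left, transpose_one_sub, transpose_one_sub, Matrix.mul_assoc]

lemma frob_projPerp_self (hU : Uᵀ * U = 1) (hV : Vᵀ * V = 1) (X Y : Matrix p q ℝ) :
    frob (projPerp U V X) (projPerp U V Y) = frob (projPerp U V X) Y := by
  rw [← frob_projPerp_left, projPerp_idem hU hV]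

lemma frob_self_eq_add (hU : Uᵀ * U = 1) (hV : Vᵀ * V = 1) (Z : Matrix p q ℝ) :
    frob Z Z = frob (projL U V Z) (projL U V Z) + frob (projPerp U V Z) (projPerp U V Z) := by
  have h := frob_projPerp_self hU hV Z Z
  have h' := frob_comm Z (projPerp U V Z)
  rw [projL_eq_sub, frob_sub_left, frob_sub_right, frob_sub_right]
  linarith

lemma projPerp_mul_transpose (hU : Uᵀ * U = 1) : projPerp U V (U * Vᵀ) = 0 := by
  have : (1 - U * Uᵀ) * U = 0 := by
    rw [Matrix.sub_mul, Matrix.mul_assoc, hU]; simp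
  rw [projPerp, ← Matrix.mul_assoc, this]; simp

lemma frob_mul_transpose_projPerp (hU : Uᵀ * U = 1) (Z : Matrix p q ℝ) :
    frob (U * Vᵀ) (projPerp U V Z) = 0 := by
  rw [← frob_projPerp_left, projPerp_mul_transpose hU]; simp [frob]

lemma projPerp_eq_zero_of_svd {L : Matrix p q ℝ} {σ : Fin r → ℝ} (h : IsCompactSVD L U σ V) :
    projPerp U V L = 0 := by
  have : (1 - U * Uᵀ) * U = 0 := by
    rw [Matrix.sub_mul, Matrix.mul_assoc, h.orthU]; simp
  rw [projPerp, h.eq, Matrix.mul_assoc U, ← Matrix.mul_assoc _ U, this]; simp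

lemma dotProduct_self_eq_add (hV : Vᵀ * V = 1) (v : q → ℝ) :
    v ⬝ᵥ v = (Vᵀ *ᵥ v) ⬝ᵥ (Vᵀ *ᵥ v) + ((1 - V * Vᵀ) *ᵥ v) ⬝ᵥ ((1 - V * Vᵀ) *ᵥ v) := by
  rw [mulVec_dotProduct_mulVec, mulVec_dotProduct_mulVec, transpose_one_sub, one_sub_mul_self hV,
    ← dotProduct_add, ← Matrix.add_mulVec, Matrix.transpose_transpose]
  simp

/-- Contractions of the form `U Vᵀ + Q` with `Q` in the complement of the tangent space. -/
lemma add_projPerp_contraction (hU : Uᵀ * U = 1) (hV : Vᵀ * V = 1) (Q : Matrix p q ℝ)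
    (hQ : frob (projPerp U V Q) (projPerp U V Q) ≤ 1) (v : q → ℝ) :
    ((U * Vᵀ + projPerp U V Q) *ᵥ v) ⬝ᵥ ((U * Vᵀ + projPerp U V Q) *ᵥ v) ≤ v ⬝ᵥ v := by
  have h1 : ((U * Vᵀ) *ᵥ v) ⬝ᵥ (projPerp U V Q *ᵥ v) = 0 := by
    have : (U * Vᵀ)ᵀ * projPerp U V Q = 0 := by
      rw [projPerp, Matrix.transpose_mul, Matrix.mul_assoc (1 - U * Uᵀ), Matrix.mul_assoc,
        ← Matrix.mul_assoc Uᵀ, transpose_mul_one_sub hU]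
      simp
    rw [mulVec_dotProduct_mulVec, this]
    simp
  have h2 : projPerp U V Q *ᵥ v = projPerp U V Q *ᵥ ((1 - V * Vᵀ) *ᵥ v) := by
    have : projPerp U V Q * (1 - V * Vᵀ) = projPerp U V Q := by
      rw [projPerp, Matrix.mul_assoc, one_sub_mul_self hV]
    rw [Matrix.mulVec_mulVec, this]
  have h3 := mulVec_dotProduct_self_le (projPerp U V Q) ((1 - V * Vᵀ) *ᵥ v)
  have h4 := dotProduct_self_nonneg' ((1 - V * Vᵀ) *ᵥ v)
  have h5 := dotProduct_self_eq_add hV v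
  have h6 := mulVec_transpose_dotProduct (V := V) hU v
  rw [← h2] at h3
  rw [Matrix.add_mulVec, add_dotProduct, dotProduct_add, dotProduct_add, h1,
    dotProduct_comm (projPerp U V Q *ᵥ v), h1]
  nlinarith

lemma projPerp_sub_smul (X Y : Matrix p q ℝ) (t : ℝ) :
    projPerp U V (X - t • Y) = projPerp U V X - t • projPerp U V Y := by
  rw [projPerp, Matrix.mul_sub (1 - U * Uᵀ), Matrix.sub_mul _ _ (1 - V * Vᵀ), Matrix.mul_smul,
    Matrix.smul_mul]
  rfl

end Proj

/-! ### Incoherence as a bound on the projections -/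

section Incoherence
variable {p q d : Type*} [Fintype p] [Fintype q] [Fintype d] [DecidableEq p] [DecidableEq q]
  {r : ℕ} {U : Matrix p (Fin r) ℝ} {V : Matrix q (Fin r) ℝ} {D : Matrix p d ℝ}
  {S : Matrix d q ℝ}

omit [DecidableEq p] [DecidableEq q] in
lemma incoherence_nonneg : 0 ≤ incoherence U V D S := by
  refine Real.sSup_nonneg fun t ⟨Z, _, _, ht⟩ => ht ▸ ?_
  rw [frobenius_norm_eq_sqrt, frobenius_norm_eq_sqrt]
  positivity

lemma frob_projL_le (hU : Uᵀ * U = 1) (hV : Vᵀ * V = 1) {Z : Matrix p q ℝ}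
    (hZ : Z ∈ dictSpace D S) :
    frob (projL U V Z) (projL U V Z) ≤ incoherence U V D S ^ 2 * frob Z Z := by
  by_cases h0 : Z = 0
  · subst h0
    simp [projL, frob]
  have hpos : 0 < frob Z Z :=
    (frob_self_nonneg Z).lt_of_ne fun h => h0 (frob_self_eq_zero h.symm)
  have hle : √(frob (projL U V Z) (projL U V Z)) / √(frob Z Z) ≤ incoherence U V D S := by
    -- The ratios are bounded by 1 because `projL` is an orthogonal projection; without a bound the
    -- real supremum would default to 0.
    refine le_csSup ⟨1, ?_⟩ ⟨Z, hZ, h0, by rw [frobenius_norm_eq_sqrt, frobenius_norm_eq_sqrt]⟩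
    rintro t ⟨Y, -, -, rfl⟩
    rw [frobenius_norm_eq_sqrt, frobenius_norm_eq_sqrt]
    refine div_le_one_of_le₀ (Real.sqrt_le_sqrt ?_) (Real.sqrt_nonneg _)
    rw [frob_self_eq_add hU hV Y]
    linarith [frob_self_nonneg (projPerp U V Y)]
  rw [div_le_iff₀ (Real.sqrt_pos.2 hpos)] at hle
  have h2 := pow_le_pow_left₀ (Real.sqrt_nonneg _) hle 2
  rwa [mul_pow, Real.sq_sqrt hpos.le, Real.sq_sqrt (frob_self_nonneg _)] at h2

lemma le_frob_projPerp (hU : Uᵀ * U = 1) (hV : Vᵀ * V = 1) {Z : Matrix p q ℝ}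
    (hZ : Z ∈ dictSpace D S) :
    (1 - incoherence U V D S ^ 2) * frob Z Z ≤ frob (projPerp U V Z) (projPerp U V Z) := by
  linarith [frob_projL_le hU hV hZ, frob_self_eq_add hU hV Z]

end Incoherence

/-! ### Consequences of the frame bounds for the Gram matrix -/

section Frame
variable {p q d : Type*} [Fintype p] [Fintype q] [Fintype d] [DecidableEq d]
  {D : Matrix p d ℝ} {αl αu : ℝ}

omit [DecidableEq d] in
lemma frob_mul_self (D : Matrix p d ℝ) (H : Matrix d q ℝ) :
    frob (D * H) (D * H) = ∑ j, (D *ᵥ H.col j) ⬝ᵥ (D *ᵥ H.col j) := by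
  rw [frob, Finset.sum_comm]
  rfl

omit [DecidableEq d] in
lemma GeneralizedFrame.lower' (h : GeneralizedFrame D αl αu) (v : d → ℝ) :
    αl * (v ⬝ᵥ v) ≤ (D *ᵥ v) ⬝ᵥ (D *ᵥ v) := by
  by_cases hv : v = 0
  · simp [hv]
  · simpa only [vecNorm_sq] using h.lower v hv

omit [DecidableEq d] in
lemma GeneralizedFrame.upper' (h : GeneralizedFrame D αl αu) (v : d → ℝ) :
    (D *ᵥ v) ⬝ᵥ (D *ᵥ v) ≤ αu * (v ⬝ᵥ v) := by
  by_cases hv : v = 0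
  · simp [hv]
  · simpa only [vecNorm_sq] using h.upper v hv

omit [DecidableEq d] in
lemma frob_eq_sum_col (H : Matrix d q ℝ) : frob H H = ∑ j, H.col j ⬝ᵥ H.col j := by
  rw [frob, Finset.sum_comm]
  rfl

omit [DecidableEq d] in
lemma GeneralizedFrame.frob_lower (h : GeneralizedFrame D αl αu) (H : Matrix d q ℝ) :
    αl * frob H H ≤ frob (D * H) (D * H) := by
  rw [frob_mul_self, frob_eq_sum_col, Finset.mul_sum]
  exact Finset.sum_le_sum fun j _ => h.lower' _

omit [DecidableEq d] in
lemma GeneralizedFrame.frob_upper (h : GeneralizedFrame D αl αu) (H : Matrix d q ℝ) :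
    frob (D * H) (D * H) ≤ αu * frob H H := by
  rw [frob_mul_self, frob_eq_sum_col, Finset.mul_sum]
  exact Finset.sum_le_sum fun j _ => h.upper' _

omit [Fintype d] [DecidableEq d] in
lemma gram_apply (D : Matrix p d ℝ) (i i' : d) :
    (Dᵀ * D) i i' = D.col i ⬝ᵥ D.col i' := rfl

lemma GeneralizedFrame.le_gram (h : GeneralizedFrame D αl αu) (i : d) : αl ≤ (Dᵀ * D) i i := by
  simpa [gram_apply] using h.lower' (Pi.single i 1)

lemma GeneralizedFrame.gram_le (h : GeneralizedFrame D αl αu) (i : d) : (Dᵀ * D) i i ≤ αu := by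
  simpa [gram_apply] using h.upper' (Pi.single i 1)

/-- Polarisation: both $\|D(e_i\pm e_{i'})\|^2$ lie in $[2\alpha_\ell,2\alpha_u]$, and they differ
by four times the entry. -/
lemma GeneralizedFrame.abs_gram_le (h : GeneralizedFrame D αl αu) {i i' : d} (hi : i ≠ i') :
    |(Dᵀ * D) i i'| ≤ (αu - αl) / 2 := by
  have h1 := h.lower' (Pi.single i 1 + Pi.single i' 1)
  have h2 := h.upper' (Pi.single i 1 + Pi.single i' 1)
  have h3 := h.lower' (Pi.single i 1 - Pi.single i' 1)
  have h4 := h.upper' (Pi.single i 1 - Pi.single i' 1)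
  simp only [Matrix.mulVec_add, Matrix.mulVec_sub, Matrix.mulVec_single_one, add_dotProduct,
    dotProduct_add, sub_dotProduct, dotProduct_sub, single_dotProduct, Pi.single_eq_same,
    Pi.single_eq_of_ne hi, Pi.single_eq_of_ne hi.symm, dotProduct_comm (D.col i') (D.col i)]
    at h1 h2 h3 h4
  rw [gram_apply, abs_le]
  constructor <;> linarith

end Frame

/-! ### Entrywise bounds from the coherence parameters -/

section Coherence
variable {p q d : Type*} [Fintype p] [Fintype q] [Fintype d] [DecidableEq p] [DecidableEq q]
  [DecidableEq d] {r : ℕ} {U : Matrix p (Fin r) ℝ} {V : Matrix q (Fin r) ℝ}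
  {D : Matrix p d ℝ} {αl αu : ℝ}

omit [DecidableEq p] in
omit [Fintype d] [DecidableEq d] in
-- A Gram matrix is positive semidefinite, so its diagonal controls every entry. Applied to $P_V$
-- and $P_UD$, it turns the diagonal quantities $\gamma_V$ and $\gamma_U$ into bounds on all
-- entries.
lemma abs_transpose_mul_self_le {x : ℝ} (W : Matrix p d ℝ) (h : ∀ i, (Wᵀ * W) i i ≤ x) (i i' : d) :
    |(Wᵀ * W) i i'| ≤ x := by
  have h1 := dotProduct_self_nonneg' (W.col i + W.col i')
  have h2 := dotProduct_self_nonneg' (W.col i - W.col i')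
  have h3 := h i
  have h4 := h i'
  rw [gram_apply] at h3 h4
  simp only [add_dotProduct, dotProduct_add, sub_dotProduct, dotProduct_sub,
    dotProduct_comm (W.col i') (W.col i)] at h1 h2
  rw [gram_apply, abs_le]
  constructor <;> linarith

omit [DecidableEq p] in
lemma proj_mul_self (hU : Uᵀ * U = 1) : (U * Uᵀ)ᵀ * (U * Uᵀ) = U * Uᵀ := by
  rw [Matrix.transpose_mul, Matrix.transpose_transpose, Matrix.mul_assoc, ← Matrix.mul_assoc Uᵀ, hU,
    Matrix.one_mul]

lemma gammaV_bound (hV : Vᵀ * V = 1) (j j' : q) : |(V * Vᵀ) j j'| ≤ gammaV V := by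
  have h := abs_transpose_mul_self_le (V * Vᵀ) (x := gammaV V) ?_ j j'
  · rwa [proj_mul_self hV] at h
  · intro i
    rw [gram_apply, ← Matrix.mulVec_single_one, ← vecNorm_sq]
    exact le_ciSup (f := fun i : q => vecNorm ((V * Vᵀ) *ᵥ Pi.single i 1) ^ 2)
      (Set.finite_range _).bddAbove i

omit [DecidableEq p] in
lemma gammaU_nonneg : 0 ≤ gammaU U D := Real.iSup_nonneg fun _ => by positivity

lemma gammaV_nonneg : 0 ≤ gammaV V := Real.iSup_nonneg fun _ => by positivity

omit [Fintype q] [Fintype d] [DecidableEq p] [DecidableEq q] [DecidableEq d] in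
lemma xiE_nonneg : 0 ≤ xiE U V D := Real.iSup_nonneg fun _ => by positivity

omit [DecidableEq p] [DecidableEq q] [DecidableEq d] in
lemma le_xiE (i : d) (j : q) : |(Dᵀ * U * Vᵀ) i j| ≤ xiE U V D :=
  le_ciSup (f := fun k : d × q => |(Dᵀ * U * Vᵀ) k.1 k.2|) (Set.finite_range _).bddAbove (i, j)

omit [DecidableEq p] in
lemma vecNorm_proj_le_gammaU (hD : GeneralizedFrame D αl αu) (i : d) :
    vecNorm ((U * Uᵀ) *ᵥ (D *ᵥ Pi.single i 1)) ^ 2 ≤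
      gammaU U D * vecNorm (D *ᵥ Pi.single i 1) ^ 2 := by
  have h := le_ciSup (f := fun i : d => vecNorm ((U * Uᵀ) *ᵥ (D *ᵥ Pi.single i 1)) ^ 2 /
    vecNorm (D *ᵥ Pi.single i 1) ^ 2) (Set.finite_range _).bddAbove i
  refine (div_le_iff₀ ?_).1 h
  rw [vecNorm_sq, Matrix.mulVec_single_one, ← gram_apply]
  exact hD.pos.trans_le (hD.le_gram i)

omit [DecidableEq p] in
lemma gammaU_bound (hU : Uᵀ * U = 1) (hD : GeneralizedFrame D αl αu) (i i' : d) :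
    |(Dᵀ * (U * Uᵀ) * D) i i'| ≤ αu * gammaU U D := by
  have e : (U * Uᵀ * D)ᵀ * (U * Uᵀ * D) = Dᵀ * (U * Uᵀ) * D := by
    rw [Matrix.transpose_mul, Matrix.mul_assoc, ← Matrix.mul_assoc (U * Uᵀ)ᵀ, proj_mul_self hU,
      ← Matrix.mul_assoc]
  have h := abs_transpose_mul_self_le (U * Uᵀ * D) (x := αu * gammaU U D) ?_ i i'
  · rwa [e] at h
  · intro i
    rw [gram_apply, ← Matrix.mulVec_single_one, ← vecNorm_sq, ← Matrix.mulVec_mulVec, mul_comm αu]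
    refine (vecNorm_proj_le_gammaU hD i).trans (mul_le_mul_of_nonneg_left ?_ gammaU_nonneg)
    rw [vecNorm_sq, Matrix.mulVec_single_one, ← gram_apply]
    exact hD.gram_le i

/-- The Gram matrix of the dictionary elements after projecting out the columns of `U`. -/
def dictGram (U : Matrix p (Fin r) ℝ) (D : Matrix p d ℝ) : Matrix d d ℝ :=
  Dᵀ * (1 - U * Uᵀ) * D

omit [DecidableEq d] in
lemma transpose_mul_projPerp (X : Matrix d q ℝ) :
    Dᵀ * projPerp U V (D * X) = dictGram U D * X * (1 - V * Vᵀ) := by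
  simp only [projPerp, dictGram, Matrix.mul_assoc]

omit [Fintype d] [DecidableEq d] in
lemma dictGram_eq (U : Matrix p (Fin r) ℝ) (D : Matrix p d ℝ) :
    dictGram U D = Dᵀ * D - Dᵀ * (U * Uᵀ) * D := by
  rw [dictGram, Matrix.mul_sub, Matrix.sub_mul, Matrix.mul_one]

lemma abs_dictGram_le (hU : Uᵀ * U = 1) (hD : GeneralizedFrame D αl αu) {i i' : d} (h : i ≠ i') :
    |dictGram U D i i'| ≤ (αu - αl) / 2 + αu * gammaU U D := by
  rw [dictGram_eq, Matrix.sub_apply]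
  exact (abs_sub _ _).trans (add_le_add (hD.abs_gram_le h) (gammaU_bound hU hD i i'))

lemma abs_dictGram_self_le (hU : Uᵀ * U = 1) (hD : GeneralizedFrame D αl αu) (i : d) :
    |dictGram U D i i| ≤ αu := by
  have e1 : dictGram U D = ((1 - U * Uᵀ) * D)ᵀ * ((1 - U * Uᵀ) * D) := by
    rw [dictGram, Matrix.transpose_mul, transpose_one_sub, Matrix.mul_assoc,
      Matrix.mul_assoc Dᵀ, ← Matrix.mul_assoc (1 - U * Uᵀ) (1 - U * Uᵀ), one_sub_mul_self hU]
  have e2 : Dᵀ * (U * Uᵀ) * D = (Uᵀ * D)ᵀ * (Uᵀ * D) := by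
    simp [Matrix.transpose_mul, Matrix.mul_assoc]
  have h1 : 0 ≤ dictGram U D i i := by
    rw [e1, gram_apply]; exact dotProduct_self_nonneg' _
  have h2 : 0 ≤ (Dᵀ * (U * Uᵀ) * D) i i := by
    rw [e2, gram_apply]; exact dotProduct_self_nonneg' _
  rw [abs_of_nonneg h1, dictGram_eq, Matrix.sub_apply]
  linarith [hD.gram_le i]

lemma abs_one_sub_le (hV : Vᵀ * V = 1) {j j' : q} (h : j ≠ j') :
    |(1 - V * Vᵀ : Matrix q q ℝ) j j'| ≤ gammaV V := by
  rw [Matrix.sub_apply, Matrix.one_apply_ne h, zero_sub, abs_neg]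
  exact gammaV_bound hV j j'

lemma abs_one_sub_self_le (hV : Vᵀ * V = 1) (j : q) : |(1 - V * Vᵀ : Matrix q q ℝ) j j| ≤ 1 := by
  have e1 : (1 - V * Vᵀ : Matrix q q ℝ) = (1 - V * Vᵀ)ᵀ * (1 - V * Vᵀ) := by
    rw [transpose_one_sub, one_sub_mul_self hV]
  have h1 : 0 ≤ (1 - V * Vᵀ : Matrix q q ℝ) j j := by
    rw [e1, gram_apply]; exact dotProduct_self_nonneg' _
  have h2 : 0 ≤ (V * Vᵀ) j j := by
    have : V * Vᵀ = Vᵀᵀ * Vᵀ := by simp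
    rw [this, gram_apply]; exact dotProduct_self_nonneg' _
  rw [abs_of_nonneg h1, Matrix.sub_apply, Matrix.one_apply_eq]
  linarith

omit [DecidableEq p] in
-- If $\gamma_U=0$ then $U^\top D=0$, and if $\gamma_V=0$ then $V=0$; either makes $D^\top UV^\top$
-- vanish. Positivity is what makes the row-sum estimate strict.
lemma gamma_pos_of_xiE_pos (hU : Uᵀ * U = 1) (hV : Vᵀ * V = 1) (hD : GeneralizedFrame D αl αu)
    (h : 0 < xiE U V D) : 0 < gammaU U D ∧ 0 < gammaV V := by
  constructor
  · by_contra h0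
    have h0 : gammaU U D = 0 := le_antisymm (not_lt.1 h0) gammaU_nonneg
    have e2 : Dᵀ * (U * Uᵀ) * D = (Uᵀ * D)ᵀ * (Uᵀ * D) := by
      simp [Matrix.transpose_mul, Matrix.mul_assoc]
    have hz : Uᵀ * D = 0 := by
      have : (Uᵀ * D)ᵀ * (Uᵀ * D) = 0 := by
        ext i i'
        have := gammaU_bound hU hD i i'
        rw [h0, mul_zero, e2] at this
        simpa using abs_nonpos_iff.1 this
      refine frob_self_eq_zero ?_
      rw [frob_eq_trace, this]; simp
    have hz' : Dᵀ * U = 0 := by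
      have := congrArg Matrix.transpose hz
      simpa using this
    refine h.ne' ?_
    simp [xiE, hz']
  · by_contra h0
    have h0 : gammaV V = 0 := le_antisymm (not_lt.1 h0) gammaV_nonneg
    have hz : Vᵀ = 0 := by
      have : V * Vᵀ = 0 := by
        ext i i'
        have := gammaV_bound hV i i'
        rw [h0] at this
        simpa using abs_nonpos_iff.1 this
      refine frob_self_eq_zero ?_
      rw [frob_eq_trace, Matrix.transpose_transpose, this]; simp
    refine h.ne' ?_
    simp [xiE, hz]

end Coherence

/-! ### Diagonal dominance of $X\mapsto AXB$ on a support -/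

section Dominance
variable {q d : Type*} [Fintype q] [Fintype d] [DecidableEq q] [DecidableEq d]

omit [DecidableEq q] [DecidableEq d] in
lemma mul_mul_apply_eq_sum (A : Matrix d d ℝ) (X : Matrix d q ℝ) (B : Matrix q q ℝ) (i : d) (j : q) :
    (A * X * B) i j = ∑ k : d × q, A i k.1 * X k.1 k.2 * B k.2 j := by
  rw [Matrix.mul_apply, Fintype.sum_prod_type_right]
  exact Finset.sum_congr rfl fun l _ => by rw [Matrix.mul_apply, Finset.sum_mul]

/-- The coefficient of $X_{kl}$ in $(AXB)_{ij}$ is $A_{ik}B_{lj}$. Away from $(i,j)$ at least one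
factor is off-diagonal, and the three weights record which: same column, same row, or neither. -/
lemma abs_mul_mul_sub_le {A : Matrix d d ℝ} {B : Matrix q q ℝ} {a u γ t : ℝ}
    (hu : 0 ≤ u) (hγ : 0 ≤ γ)
    (hA : ∀ i i', i ≠ i' → |A i i'| ≤ a) (hA' : ∀ i, |A i i| ≤ u)
    (hB : ∀ j j', j ≠ j' → |B j j'| ≤ γ) (hB' : ∀ j, |B j j| ≤ 1)
    {Ω : Finset (d × q)} {X : Matrix d q ℝ} (hX : ∀ i j, (i, j) ∉ Ω → X i j = 0)
    (ht : ∀ i j, |X i j| ≤ t) (i : d) (j : q) :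
    |(A * X * B) i j - A i i * X i j * B j j| ≤
      (∑ k ∈ Ω.erase (i, j), if k.2 = j then a else if k.1 = i then u * γ else a * γ) * t := by
  have h1 : (A * X * B) i j - A i i * X i j * B j j =
      ∑ k ∈ Ω.erase (i, j), A i k.1 * X k.1 k.2 * B k.2 j := by
    rw [mul_mul_apply_eq_sum, ← Finset.add_sum_erase _ _ (Finset.mem_univ (i, j)),
      add_sub_cancel_left]
    refine (Finset.sum_subset (Finset.erase_subset_erase _ (Finset.subset_univ _)) ?_).symm
    intro k hk hk'
    have : k ∉ Ω := fun h => hk' (Finset.mem_erase.2 ⟨(Finset.mem_erase.1 hk).1, h⟩)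
    rw [hX k.1 k.2 this]; ring
  rw [h1, Finset.sum_mul]
  refine (Finset.abs_sum_le_sum_abs _ _).trans (Finset.sum_le_sum fun k hk => ?_)
  have ht0 : 0 ≤ t := (abs_nonneg _).trans (ht i j)
  have hne := (Finset.mem_erase.1 hk).1
  rw [abs_mul, abs_mul, mul_right_comm]
  refine mul_le_mul ?_ (ht _ _) (abs_nonneg _) ?_
  · split_ifs with h2 h3
    · have h3 : i ≠ k.1 := fun h => hne (Prod.ext h.symm h2)
      have := hA i k.1 h3
      have h4 := hB' j
      rw [← h2] at h4 ⊢
      nlinarith [abs_nonneg (A i k.1), abs_nonneg (B k.2 k.2)]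
    · rw [h3]
      exact mul_le_mul (hA' i) (hB _ _ h2) (abs_nonneg _) hu
    · have := hA i k.1 (Ne.symm h3)
      exact mul_le_mul this (hB _ _ h2) (abs_nonneg _) ((abs_nonneg _).trans this)
  · split_ifs with h2 h3
    · have h3 : i ≠ k.1 := fun h => hne (Prod.ext h.symm h2)
      exact (abs_nonneg _).trans (hA i k.1 h3)
    · positivity
    · exact mul_nonneg ((abs_nonneg _).trans (hA i k.1 (Ne.symm h3))) hγ

/-- Positions in one column are told apart by their row and positions in one row by their column,
which caps the first two counts. -/
lemma exists_counts {Ω : Finset (d × q)} {se : ℕ} (hΩ : Ω.card ≤ se) (i : d) (j : q)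
    (a b c : ℝ) :
    ∃ n₁ n₂ n₃ : ℕ, n₁ + n₂ + n₃ ≤ se ∧ n₁ ≤ Fintype.card d ∧ n₂ ≤ Fintype.card q ∧
      (∑ k ∈ Ω.erase (i, j), if k.2 = j then a else if k.1 = i then b else c) =
        n₁ * a + n₂ * b + n₃ * c := by
  set Ω' := Ω.erase (i, j)
  refine ⟨(Ω'.filter (fun k => k.2 = j)).card,
    ((Ω'.filter (fun k => ¬ k.2 = j)).filter (fun k => k.1 = i)).card,
    ((Ω'.filter (fun k => ¬ k.2 = j)).filter (fun k => ¬ k.1 = i)).card, ?_, ?_, ?_, ?_⟩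
  · rw [add_assoc, Finset.card_filter_add_card_filter_not, Finset.card_filter_add_card_filter_not]
    exact (Finset.card_erase_le).trans hΩ
  · refine Finset.card_le_card_of_injOn Prod.fst (fun _ _ => Finset.mem_univ _) ?_
    intro x hx y hy hxy
    simp only [Finset.coe_filter, Set.mem_ofPred_eq] at hx hy
    exact Prod.ext hxy (hx.2.trans hy.2.symm)
  · refine Finset.card_le_card_of_injOn Prod.snd (fun _ _ => Finset.mem_univ _) ?_
    intro x hx y hy hxy
    simp only [Finset.coe_filter, Finset.mem_filter, Set.mem_ofPred_eq] at hx hy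
    exact Prod.ext (hx.2.trans hy.2.symm) hxy
  · rw [Finset.sum_ite, Finset.sum_ite]
    simp [add_assoc]

lemma row_sum_le {Ω : Finset (d × q)} {se : ℕ} (hΩ : Ω.card ≤ se) (i : d) (j : q)
    {a u γ : ℝ} (ha : 0 ≤ a) (hu : 0 ≤ u) (hγ : 0 ≤ γ) :
    (∑ k ∈ Ω.erase (i, j), if k.2 = j then a else if k.1 = i then u * γ else a * γ) ≤
      a * (min (se : ℝ) (Fintype.card d) + se * γ) + u * γ * min (se : ℝ) (Fintype.card q) := by
  obtain ⟨n₁, n₂, n₃, h, h1, h2, e⟩ := exists_counts hΩ i j a (u * γ) (a * γ)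
  rw [e]
  have h1' : (n₁ : ℝ) ≤ min (se : ℝ) (Fintype.card d) :=
    le_min (by exact_mod_cast (by omega : n₁ ≤ se)) (by exact_mod_cast h1)
  have h2' : (n₂ : ℝ) ≤ min (se : ℝ) (Fintype.card q) :=
    le_min (by exact_mod_cast (by omega : n₂ ≤ se)) (by exact_mod_cast h2)
  have h3' : (n₃ : ℝ) ≤ se := by exact_mod_cast (by omega : n₃ ≤ se)
  have := mul_le_mul_of_nonneg_left h1' ha
  have := mul_le_mul_of_nonneg_left h2' (mul_nonneg hu hγ)
  have := mul_le_mul_of_nonneg_left h3' (mul_nonneg ha hγ)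
  linarith

/-- The bound of `row_sum_le` cannot be attained: the counts share a total of `se`, so $n_3=s_e$
forces $n_1=0$, below the positive value $\min(s_e,d)$ allotted to it. -/
lemma row_sum_lt {Ω : Finset (d × q)} {se : ℕ} (hse : 0 < se) (hΩ : Ω.card ≤ se) (i : d) (j : q)
    {a u γ : ℝ} (ha : 0 < a) (hu : 0 ≤ u) (hγ : 0 < γ) :
    (∑ k ∈ Ω.erase (i, j), if k.2 = j then a else if k.1 = i then u * γ else a * γ) <
      a * (min (se : ℝ) (Fintype.card d) + se * γ) + u * γ * min (se : ℝ) (Fintype.card q) := by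
  obtain ⟨n₁, n₂, n₃, h, h1, h2, e⟩ := exists_counts hΩ i j a (u * γ) (a * γ)
  rw [e]
  have h1' : (n₁ : ℝ) ≤ min (se : ℝ) (Fintype.card d) :=
    le_min (by exact_mod_cast (by omega : n₁ ≤ se)) (by exact_mod_cast h1)
  have h2' : (n₂ : ℝ) ≤ min (se : ℝ) (Fintype.card q) :=
    le_min (by exact_mod_cast (by omega : n₂ ≤ se)) (by exact_mod_cast h2)
  have h3' : (n₃ : ℝ) ≤ se := by exact_mod_cast (by omega : n₃ ≤ se)
  have hlt : (n₁ : ℝ) + γ * n₃ < min (se : ℝ) (Fintype.card d) + γ * se := by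
    rcases eq_or_ne n₃ se with h3 | h3
    · have : n₁ = 0 := by omega
      have hd : (0 : ℝ) < min (se : ℝ) (Fintype.card d) :=
        lt_min (by exact_mod_cast hse) (by exact_mod_cast Fintype.card_pos_iff.2 ⟨i⟩)
      rw [this, h3]; push_cast; linarith
    · have : (n₃ : ℝ) < se := by exact_mod_cast (by omega : n₃ < se)
      linarith [mul_lt_mul_of_pos_left this hγ]
  have := mul_lt_mul_of_pos_left hlt ha
  have := mul_le_mul_of_nonneg_left h2' (mul_nonneg hu hγ.le)
  linarith

/-- Varah's bound for the operator `X ↦ A X B` on matrices supported on `Ω`. -/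
lemma abs_le_of_dominant {A : Matrix d d ℝ} {B : Matrix q q ℝ} {Ω : Finset (d × q)} {c δ : ℝ}
    (hrow : ∀ (X : Matrix d q ℝ) (t : ℝ), (∀ i j, (i, j) ∉ Ω → X i j = 0) →
      (∀ i j, |X i j| ≤ t) → ∀ i j, |(A * X * B) i j - A i i * X i j * B j j| ≤ c * t)
    (hdiag : ∀ i j, (i, j) ∈ Ω → δ ≤ A i i * B j j) (hcδ : c < δ)
    {X : Matrix d q ℝ} (hX : ∀ i j, (i, j) ∉ Ω → X i j = 0) {s : ℝ} (hs : 0 ≤ s)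
    (h : ∀ i j, (i, j) ∈ Ω → |(A * X * B) i j| ≤ s) (i : d) (j : q) :
    (δ - c) * |X i j| ≤ s := by
  have : Nonempty (d × q) := ⟨(i, j)⟩
  -- At an entry of largest modulus the diagonal term outweighs all the others together.
  obtain ⟨⟨k, l⟩, hk⟩ := Finite.exists_max (fun k : d × q => |X k.1 k.2|)
  have h1 := hk (i, j)
  simp only at h1
  by_cases hm : (k, l) ∈ Ω
  · have h2 := hrow X |X k l| hX (fun i j => hk (i, j)) k l
    have h3 := h k l hm
    have h4 : δ * |X k l| ≤ |A k k * X k l * B l l| := by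
      rw [mul_right_comm, abs_mul]
      exact mul_le_mul_of_nonneg_right ((hdiag k l hm).trans (le_abs_self _)) (abs_nonneg _)
    have h5 : |A k k * X k l * B l l| ≤
        |(A * X * B) k l| + |(A * X * B) k l - A k k * X k l * B l l| := by
      have := abs_sub ((A * X * B) k l) ((A * X * B) k l - A k k * X k l * B l l)
      rwa [sub_sub_cancel] at this
    have h6 := mul_le_mul_of_nonneg_left h1 (sub_pos.2 hcδ).le
    linarith
  · rw [hX k l hm, abs_zero] at h1
    rw [le_antisymm h1 (abs_nonneg _), mul_zero]
    exact hs

lemma exists_mul_mul_eq {A : Matrix d d ℝ} {B : Matrix q q ℝ} {Ω : Finset (d × q)} {c δ : ℝ}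
    (hrow : ∀ (X : Matrix d q ℝ) (t : ℝ), (∀ i j, (i, j) ∉ Ω → X i j = 0) →
      (∀ i j, |X i j| ≤ t) → ∀ i j, |(A * X * B) i j - A i i * X i j * B j j| ≤ c * t)
    (hdiag : ∀ i j, (i, j) ∈ Ω → δ ≤ A i i * B j j) (hcδ : c < δ) (b : Matrix d q ℝ) :
    ∃ X : Matrix d q ℝ, (∀ i j, (i, j) ∉ Ω → X i j = 0) ∧
      ∀ i j, (i, j) ∈ Ω → (A * X * B) i j = b i j := by
  -- Letting the map be the identity off `Ω` gives an endomorphism of a finite-dimensional space: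
  -- injectivity, from dominance, yields surjectivity, and zero data off `Ω` force the solution to
  -- be supported on `Ω`.
  let T : Matrix d q ℝ →ₗ[ℝ] Matrix d q ℝ :=
    { toFun := fun X => Matrix.of fun i j => if (i, j) ∈ Ω then (A * X * B) i j else X i j
      map_add' := fun X Y => by
        ext i j
        by_cases h : (i, j) ∈ Ω <;> simp [h, Matrix.mul_add, Matrix.add_mul]
      map_smul' := fun t X => by
        ext i j
        by_cases h : (i, j) ∈ Ω <;> simp [h] }
  have hT : ∀ X i j, T X i j = if (i, j) ∈ Ω then (A * X * B) i j else X i j := fun _ _ _ => rfl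
  have hinj : Function.Injective T := by
    rw [injective_iff_map_eq_zero]
    intro X hX
    have h0 : ∀ i j, (i, j) ∉ Ω → X i j = 0 := fun i j h => by
      have := congrFun (congrFun hX i) j
      rwa [hT, if_neg h] at this
    have h1 : ∀ i j, (i, j) ∈ Ω → |(A * X * B) i j| ≤ 0 := fun i j h => by
      have := congrFun (congrFun hX i) j
      rw [hT, if_pos h] at this
      rw [this]; simp
    ext i j
    have h2 := abs_le_of_dominant hrow hdiag hcδ h0 le_rfl h1 i j
    have h3 : |X i j| ≤ 0 := by
      by_contra h
      linarith [mul_pos (sub_pos.2 hcδ) (not_le.1 h)]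
    simpa using abs_nonpos_iff.1 h3
  obtain ⟨X, hX⟩ := (LinearMap.injective_iff_surjective.1 hinj)
    (Matrix.of fun i j => if (i, j) ∈ Ω then b i j else 0)
  refine ⟨X, fun i j h => ?_, fun i j h => ?_⟩
  · have := congrFun (congrFun hX i) j
    rwa [hT, if_neg h, Matrix.of_apply, if_neg h] at this
  · have := congrFun (congrFun hX i) j
    rwa [hT, if_pos h, Matrix.of_apply, if_pos h] at this

end Dominance

/-! ### From certificates to optimality and uniqueness -/

section Optimality
variable {p q d : Type*} [Fintype p] [Fintype q] [Fintype d] [DecidableEq p] [DecidableEq q]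
  [DecidableEq d] {r : ℕ} {U : Matrix p (Fin r) ℝ} {V : Matrix q (Fin r) ℝ} {σ : Fin r → ℝ}
  {L : Matrix p q ℝ} {D : Matrix p d ℝ} {S : Matrix d q ℝ} {lam : ℝ}

lemma nuclearNorm_sub_ge (h : IsCompactSVD L U σ V) {Q : Matrix p q ℝ}
    (hQ : frob (projPerp U V Q) (projPerp U V Q) ≤ 1) (Y : Matrix p q ℝ) :
    nuclearNorm L - frob (U * Vᵀ + projPerp U V Q) Y ≤ nuclearNorm (L - Y) := by
  have h1 := frob_le_mul_nuclearNorm (U * Vᵀ + projPerp U V Q) (L - Y) 1 zero_le_one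
    (fun v => by simpa using add_projPerp_contraction h.orthU h.orthV Q hQ v)
  have h2 : frob (U * Vᵀ + projPerp U V Q) L = ∑ k, σ k := by
    rw [frob_add_left, frob_mul_transpose_eq_sum h, frob_projPerp_left,
      projPerp_eq_zero_of_svd h]
    simp [frob]
  rw [frob_sub_right, h2] at h1
  linarith [nuclearNorm_le_sum h]

/-- The hypotheses say that $c$ is a subgradient of $\lambda|\cdot|$ at $s$. -/
lemma mul_abs_add_ge {s h c : ℝ} (hlam : 0 ≤ lam) (h1 : s ≠ 0 → c = lam * Real.sign s)
    (h2 : s = 0 → |c| ≤ lam) : lam * |s| + c * h ≤ lam * |s + h| := by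
  rcases lt_trichotomy s 0 with hs | hs | hs
  · rw [h1 hs.ne, Real.sign_of_neg hs, abs_of_neg hs]
    nlinarith [neg_abs_le (s + h)]
  · subst hs
    have := h2 rfl
    have h3 : c * h ≤ |c| * |h| := (le_abs_self _).trans (abs_mul _ _).le
    have := mul_le_mul_of_nonneg_right this (abs_nonneg h)
    simp only [abs_zero, mul_zero, zero_add]
    linarith
  · rw [h1 hs.ne', Real.sign_of_pos hs, abs_of_pos hs]
    nlinarith [le_abs_self (s + h)]

omit [DecidableEq q] [DecidableEq d] in
lemma mul_l1Norm_add_ge {Λ : Matrix d q ℝ} (hlam : 0 ≤ lam)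
    (h1 : ∀ i j, S i j ≠ 0 → Λ i j = lam * Real.sign (S i j))
    (h2 : ∀ i j, S i j = 0 → |Λ i j| ≤ lam) (H : Matrix d q ℝ) :
    lam * l1Norm S + frob Λ H ≤ lam * l1Norm (S + H) := by
  simp only [l1Norm, frob, Finset.mul_sum, ← Finset.sum_add_distrib]
  exact Finset.sum_le_sum fun i _ => Finset.sum_le_sum fun j _ =>
    mul_abs_add_ge hlam (h1 i j) (h2 i j)

omit [DecidableEq q] [DecidableEq d] in
-- Equality in the subgradient inequality holds entry by entry, and where $S$ vanishes the strict
-- bound on $\Lambda$ leaves only $H_{ij}=0$.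
lemma mem_supportSpace_of_l1Norm_le {Λ : Matrix d q ℝ} (hlam : 0 ≤ lam)
    (h1 : ∀ i j, S i j ≠ 0 → Λ i j = lam * Real.sign (S i j))
    (h2 : ∀ i j, S i j = 0 → |Λ i j| < lam) {H : Matrix d q ℝ}
    (h : lam * l1Norm (S + H) ≤ lam * l1Norm S + frob Λ H) : H ∈ supportSpace S := by
  have h0 : ∑ k : d × q, (lam * |S k.1 k.2 + H k.1 k.2| -
      (lam * |S k.1 k.2| + Λ k.1 k.2 * H k.1 k.2)) ≤ 0 := by
    rw [Fintype.sum_prod_type]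
    simp only [Finset.sum_sub_distrib, Finset.sum_add_distrib, ← Finset.mul_sum]
    simpa [l1Norm, frob] using h
  have hn : ∀ k ∈ (Finset.univ : Finset (d × q)), 0 ≤ lam * |S k.1 k.2 + H k.1 k.2| -
      (lam * |S k.1 k.2| + Λ k.1 k.2 * H k.1 k.2) := fun k _ =>
    sub_nonneg.2 (mul_abs_add_ge hlam (h1 k.1 k.2) fun e => (h2 k.1 k.2 e).le)
  have he := (Finset.sum_eq_zero_iff_of_nonneg hn).1 (le_antisymm h0 (Finset.sum_nonneg hn))
  intro i j hij
  have h3 := he (i, j) (Finset.mem_univ _)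
  simp only [hij, zero_add, abs_zero, mul_zero] at h3
  by_contra hH
  have h4 := mul_lt_mul_of_pos_right (h2 i j hij) (abs_pos.2 hH)
  have h5 : Λ i j * H i j ≤ |Λ i j| * |H i j| := (le_abs_self _).trans (abs_mul _ _).le
  linarith

omit [DecidableEq d] in
lemma objective_le_of_certificate (h : IsCompactSVD L U σ V) {Q : Matrix p q ℝ}
    (hQ : frob (projPerp U V Q) (projPerp U V Q) ≤ 1) (hlam : 0 ≤ lam)
    (h1 : ∀ i j, S i j ≠ 0 → (Dᵀ * (U * Vᵀ + projPerp U V Q)) i j = lam * Real.sign (S i j))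
    (h2 : ∀ i j, S i j = 0 → |(Dᵀ * (U * Vᵀ + projPerp U V Q)) i j| ≤ lam) (H : Matrix d q ℝ) :
    objective lam (L, S) ≤ objective lam (L - D * H, S + H) := by
  have h3 := nuclearNorm_sub_ge h hQ (D * H)
  have h4 := mul_l1Norm_add_ge hlam h1 h2 H
  rw [frob_mul_left, Matrix.transpose_transpose] at h4
  simp only [objective]
  linarith

omit [DecidableEq d] in
lemma of_objective_le_of_certificate (h : IsCompactSVD L U σ V) {Q : Matrix p q ℝ}
    (hQ : frob (projPerp U V Q) (projPerp U V Q) < 1) (hlam : 0 ≤ lam)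
    (h1 : ∀ i j, S i j ≠ 0 → (Dᵀ * (U * Vᵀ + projPerp U V Q)) i j = lam * Real.sign (S i j))
    (h2 : ∀ i j, S i j = 0 → |(Dᵀ * (U * Vᵀ + projPerp U V Q)) i j| < lam) {H : Matrix d q ℝ}
    (hle : objective lam (L - D * H, S + H) ≤ objective lam (L, S)) :
    projPerp U V (D * H) = 0 ∧ H ∈ supportSpace S := by
  simp only [objective] at hle
  have h4 := mul_l1Norm_add_ge hlam h1 (fun i j e => (h2 i j e).le) H
  have h5 := nuclearNorm_sub_ge h hQ.le (D * H)
  refine ⟨?_, mem_supportSpace_of_l1Norm_le hlam h1 h2 ?_⟩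
  swap
  · rw [frob_mul_left, Matrix.transpose_transpose]
    linarith
  rw [frob_mul_left, Matrix.transpose_transpose] at h4
  by_contra hne
  set F := frob (projPerp U V (D * H)) (projPerp U V (D * H)) with hF
  have hFpos : 0 < F := (frob_self_nonneg _).lt_of_ne fun e => hne (frob_self_eq_zero e.symm)
  -- As $\|Q\|_F<1$ is strict, $Q$ may be tilted slightly against $DH$ and remain admissible; the
  -- nuclear norm bound then improves by $\varepsilon F>0$, a contradiction.
  obtain ⟨ε, hε, hε1⟩ : ∃ ε : ℝ, 0 < ε ∧ frob (projPerp U V (Q - ε • (D * H)))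
      (projPerp U V (Q - ε • (D * H))) ≤ 1 := by
    have hc : ContinuousAt (fun ε : ℝ => frob (projPerp U V (Q - ε • (D * H)))
        (projPerp U V (Q - ε • (D * H)))) 0 := by
      simp only [projPerp_sub_smul, frob_sub_left, frob_sub_right, frob_smul_left, frob_smul_right]
      fun_prop
    have hev := hc.eventually_lt (continuousAt_const (y := (1 : ℝ))) (by simpa using hQ)
    obtain ⟨ε, hε, hpos⟩ :=
      ((hev.filter_mono (nhdsWithin_le_nhds (s := Set.Ioi 0))).and self_mem_nhdsWithin).exists
    exact ⟨ε, hpos, hε.le⟩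
  have h6 := nuclearNorm_sub_ge h hε1 (D * H)
  have h7 : frob (projPerp U V (Q - ε • (D * H))) (D * H) =
      frob (projPerp U V Q) (D * H) - ε * F := by
    rw [projPerp_sub_smul, frob_sub_left, frob_smul_left, hF, frob_projPerp_self h.orthU h.orthV]
  rw [frob_add_left] at h4
  rw [frob_add_left, h7] at h6
  linarith [mul_pos hε hFpos]

omit [DecidableEq p] in
/-- Subtracting a nonzero matrix whose columns are orthogonal to the column space of `L` strictly
increases the nuclear norm. -/
lemma eq_zero_of_nuclearNorm_sub_le (h : IsCompactSVD L U σ V) {Z : Matrix p q ℝ}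
    (hZ : Uᵀ * Z = 0) (hle : nuclearNorm (L - Z) ≤ nuclearNorm L) : Z = 0 := by
  by_contra hne
  set b := frob Z Z with hb
  have hbpos : 0 < b := (frob_self_nonneg _).lt_of_ne fun e => hne (frob_self_eq_zero e.symm)
  set N := ∑ k, σ k with hN
  have hN0 : 0 ≤ N := Finset.sum_nonneg fun k _ => (h.pos k).le
  set ε := 1 / (N + 1) with hε
  have hεpos : 0 < ε := by positivity
  have hNε : N * ε < 1 := by
    rw [hε, mul_one_div, div_lt_one (by positivity)]; linarith
  -- The column spaces of $U$ and $Z$ are orthogonal, so the squared norm exceeds 1 by at most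
  -- $\varepsilon^2b$. Pairing this test matrix with $L-Z$ gains $\varepsilon b$, first order in
  -- $\varepsilon$, against a loss of $N\varepsilon^2b/2$; $N\varepsilon<1$ makes the gain win.
  have hκ : ∀ v, ((U * Vᵀ - ε • Z) *ᵥ v) ⬝ᵥ ((U * Vᵀ - ε • Z) *ᵥ v) ≤
      (1 + ε ^ 2 * b / 2) ^ 2 * (v ⬝ᵥ v) := by
    intro v
    have h1 : ((U * Vᵀ) *ᵥ v) ⬝ᵥ (Z *ᵥ v) = 0 := by
      rw [mulVec_dotProduct_mulVec, Matrix.transpose_mul, Matrix.mul_assoc, hZ]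
      simp
    have h2 := mulVec_transpose_dotProduct (V := V) h.orthU v
    have h3 := dotProduct_self_eq_add h.orthV v
    have h4 := dotProduct_self_nonneg' ((1 - V * Vᵀ) *ᵥ v)
    have h5 := mulVec_dotProduct_self_le Z v
    have h6 := dotProduct_self_nonneg' v
    rw [Matrix.sub_mulVec, sub_dotProduct, dotProduct_sub, dotProduct_sub, Matrix.smul_mulVec,
      smul_dotProduct, dotProduct_smul, dotProduct_smul, smul_dotProduct,
      dotProduct_comm (Z *ᵥ v) ((U * Vᵀ) *ᵥ v), h1]
    simp only [smul_eq_mul, mul_zero, sub_zero, zero_sub]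
    have h7 := mul_le_mul_of_nonneg_left h5 (sq_nonneg ε)
    have h8 := mul_nonneg (sq_nonneg (ε ^ 2 * b / 2)) h6
    nlinarith
  have h1 := frob_le_mul_nuclearNorm (U * Vᵀ - ε • Z) (L - Z) _ (by positivity) hκ
  have h2 : frob (U * Vᵀ) Z = 0 := by
    rw [frob_mul_left, hZ]; simp [frob]
  have h3 : frob Z L = 0 := by
    rw [frob_comm, h.eq, Matrix.mul_assoc, frob_mul_left, hZ]; simp [frob]
  rw [frob_sub_left, frob_sub_right, frob_sub_right, frob_smul_left, frob_smul_left, h2, h3,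
    frob_mul_transpose_eq_sum h, ← hN, ← hb] at h1
  have h4 := mul_le_mul_of_nonneg_left (hle.trans (nuclearNorm_le_sum h))
    (by positivity : 0 ≤ 1 + ε ^ 2 * b / 2)
  rw [← hN] at h4
  have h5 : ε * b ≤ N * ε * (ε * b) / 2 := by linarith
  nlinarith [mul_pos hεpos hbpos]

end Optimality

/-! ### Construction of the dual certificate -/

section Certificate
variable {p q d : Type*} [Fintype p] [Fintype q] [Fintype d] [DecidableEq p] [DecidableEq q]
  [DecidableEq d] {r : ℕ} {U : Matrix p (Fin r) ℝ} {V : Matrix q (Fin r) ℝ}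
  {D : Matrix p d ℝ} {S : Matrix d q ℝ} {αl αu lam : ℝ} {se : ℕ}

omit [DecidableEq d] in
lemma frob_projPerp_mul_self (hU : Uᵀ * U = 1) (hV : Vᵀ * V = 1) (X : Matrix d q ℝ) :
    frob (projPerp U V (D * X)) (projPerp U V (D * X)) =
      frob X (Dᵀ * projPerp U V (D * X)) := by
  rw [frob_projPerp_self hU hV, frob_comm, frob_mul_left]

/-- The product is $\|(1-P_U)De_ie_j^\top(1-P_V)\|_F^2$. Incoherence and the lower frame bound give
$\alpha_\ell(1-\mu^2)$, which is weakened to the stated form. -/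
lemma le_dictGram_mul (hU : Uᵀ * U = 1) (hV : Vᵀ * V = 1) (hD : GeneralizedFrame D αl αu)
    (hμ : incoherence U V D S < 1) {i : d} {j : q} (hij : S i j ≠ 0) :
    αl * (1 - incoherence U V D S) ^ 2 ≤ dictGram U D i i * (1 - V * Vᵀ : Matrix q q ℝ) j j := by
  set X : Matrix d q ℝ := Matrix.single i j 1 with hX
  have hmem : D * X ∈ dictSpace D S := by
    refine ⟨X, fun k l h => ?_, rfl⟩
    rw [hX, Matrix.single_apply, if_neg]
    rintro ⟨rfl, rfl⟩
    exact hij h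
  have hXfrob : ∀ Y : Matrix d q ℝ, frob X Y = Y i j := fun Y => by
    simp [frob, hX, Matrix.single_apply, ite_and]
  have h1 := le_frob_projPerp hU hV hmem
  rw [frob_projPerp_mul_self hU hV, transpose_mul_projPerp, hXfrob] at h1
  have h2 := hD.frob_lower X
  have h3 : X i j = 1 := by simp [hX]
  have h4 : (dictGram U D * X * (1 - V * Vᵀ) : Matrix d q ℝ) i j =
      dictGram U D i i * (1 - V * Vᵀ : Matrix q q ℝ) j j := by
    rw [mul_mul_apply_eq_sum, Finset.sum_eq_single (i, j)]
    · simp [hX]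
    · rintro ⟨k, l⟩ - hkl
      simp only [hX]
      rw [Matrix.single_apply, if_neg]
      · simp
      · rintro ⟨rfl, rfl⟩
        exact hkl rfl
    · simp
  rw [h4] at h1
  rw [hXfrob, h3, mul_one] at h2
  have hμ0 := incoherence_nonneg (U := U) (V := V) (D := D) (S := S)
  set μ := incoherence U V D S
  have h5 : 0 ≤ 1 - μ ^ 2 := by nlinarith
  have h6 := mul_le_mul_of_nonneg_left h2 h5
  have h7 : (1 - μ) ^ 2 ≤ 1 - μ ^ 2 := by nlinarith
  have h8 := mul_le_mul_of_nonneg_left h7 hD.pos.le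
  linarith

omit [DecidableEq d] in
lemma frob_mul_transpose_le (hU : Uᵀ * U = 1) (hV : Vᵀ * V = 1) (hD : GeneralizedFrame D αl αu)
    {X : Matrix d q ℝ} (hX : X ∈ supportSpace S) :
    |frob X (Dᵀ * (U * Vᵀ))| ≤ √(r * αu) * incoherence U V D S * √(frob X X) := by
  have h1 := abs_frob_le (U * Vᵀ) (projL U V (D * X))
  rw [frob_mul_transpose_self hU hV, projL_eq_sub, frob_sub_right,
    frob_mul_transpose_projPerp hU, sub_zero, ← projL_eq_sub] at h1
  rw [← frob_mul_left, frob_comm]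
  refine h1.trans ?_
  have hμ0 := incoherence_nonneg (U := U) (V := V) (D := D) (S := S)
  have h2 : √(frob (projL U V (D * X)) (projL U V (D * X))) ≤
      incoherence U V D S * (√αu * √(frob X X)) := by
    refine (Real.sqrt_le_sqrt (frob_projL_le hU hV ⟨X, hX, rfl⟩)).trans ?_
    rw [Real.sqrt_mul (sq_nonneg _), Real.sqrt_sq hμ0, ← Real.sqrt_mul (hD.pos.le.trans hD.le)]
    exact mul_le_mul_of_nonneg_left (Real.sqrt_le_sqrt (hD.frob_upper X)) hμ0
  refine (mul_le_mul_of_nonneg_left h2 (Real.sqrt_nonneg _)).trans_eq ?_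
  rw [Real.sqrt_mul (Nat.cast_nonneg r)]
  ring

omit [DecidableEq q] [DecidableEq d] in
lemma frob_sign_le (hS : numNonzeros S ≤ se) :
    frob (Matrix.of fun i j => Real.sign (S i j)) (Matrix.of fun i j => Real.sign (S i j)) ≤ se := by
  have h1 : ∀ k : d × q, Real.sign (S k.1 k.2) * Real.sign (S k.1 k.2) =
      if S k.1 k.2 ≠ 0 then 1 else 0 := by
    intro k
    rcases Real.sign_apply_eq (S k.1 k.2) with h | h | h
    · have : S k.1 k.2 ≠ 0 := fun e => by rw [e, Real.sign_zero] at h; norm_num at h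
      simp [h, this]
    · simp [Real.sign_eq_zero_iff.1 h]
    · have : S k.1 k.2 ≠ 0 := fun e => by rw [e, Real.sign_zero] at h; norm_num at h
      simp [h, this]
  have h2 : frob (Matrix.of fun i j => Real.sign (S i j))
      (Matrix.of fun i j => Real.sign (S i j)) = numNonzeros S := by
    simp only [frob, Matrix.of_apply]
    rw [← Fintype.sum_prod_type' (fun i j => Real.sign (S i j) * Real.sign (S i j))]
    rw [Finset.sum_congr rfl fun k _ => h1 k, numNonzeros, Set.ncard_eq_toFinset_card',
      Finset.sum_boole]
    simp
  rw [h2]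
  exact_mod_cast hS

/-- The supremum-norm and Frobenius-norm estimates for the least-squares dual certificate. -/
lemma exists_certificate (hU : Uᵀ * U = 1) (hV : Vᵀ * V = 1) (hD : GeneralizedFrame D αl αu)
    (hse : 0 < se) (hS : numNonzeros S ≤ se) (hμ1 : incoherence U V D S < 1) {c : ℝ}
    (hc : c = cConst αl αu (gammaU U D) (gammaV V) se (Fintype.card d) (Fintype.card q))
    (hcβ : c < αl * (1 - incoherence U V D S) ^ 2) (hlam : 0 ≤ lam)
    (hC1 : c / (αl * (1 - incoherence U V D S) ^ 2 - c) < 1)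
    (hK : lam * √se + √(r * αu) * incoherence U V D S ≤ √αl * (1 - incoherence U V D S))
    (hξ : xiE U V D + c / (αl * (1 - incoherence U V D S) ^ 2 - c) * (lam + xiE U V D) ≤ lam) :
    ∃ Q : Matrix p q ℝ, frob (projPerp U V Q) (projPerp U V Q) ≤ 1 ∧
      ((lam * √se + √(r * αu) * incoherence U V D S < √αl * (1 - incoherence U V D S) ∨
        0 < incoherence U V D S) → frob (projPerp U V Q) (projPerp U V Q) < 1) ∧
      (∀ i j, S i j ≠ 0 →
        (Dᵀ * (U * Vᵀ + projPerp U V Q)) i j = lam * Real.sign (S i j)) ∧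
      (∀ i j, S i j = 0 → |(Dᵀ * (U * Vᵀ + projPerp U V Q)) i j| ≤ lam) ∧
      (0 < lam → ∀ i j, S i j = 0 → |(Dᵀ * (U * Vᵀ + projPerp U V Q)) i j| < lam) := by
  have hμ0 := incoherence_nonneg (U := U) (V := V) (D := D) (S := S)
  have hdiag := fun i j => le_dictGram_mul (S := S) (i := i) (j := j) hU hV hD hμ1
  have hproj := fun X : Matrix d q ℝ => frob_mul_transpose_le (X := X) (S := S) hU hV hD
  have hperp := fun X : Matrix d q ℝ =>
    fun hX : X ∈ supportSpace S => le_frob_projPerp hU hV (S := S) ⟨X, hX, rfl⟩ (Z := D * X)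
  set μ := incoherence U V D S
  set ξ := xiE U V D with hξdef
  set γU := gammaU U D with hγU
  set γV := gammaV V with hγV
  have hξ0 : 0 ≤ ξ := xiE_nonneg
  have hγU0 : 0 ≤ γU := gammaU_nonneg
  have hγV0 : 0 ≤ γV := gammaV_nonneg
  have hαu : 0 < αu := hD.pos.trans_le hD.le
  set A := dictGram U D with hA
  set B : Matrix q q ℝ := 1 - V * Vᵀ with hB
  set a := (αu - αl) / 2 + αu * γU with ha
  have ha0 : 0 ≤ a := by
    have := hD.le
    have := mul_nonneg hαu.le hγU0
    rw [ha]; linarith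
  have hcEq : c = a * (min (se : ℝ) (Fintype.card d) + se * γV) +
      αu * γV * min (se : ℝ) (Fintype.card q) := by
    rw [hc, cConst, ha]; ring
  set Ω : Finset (d × q) := Finset.univ.filter (fun k => S k.1 k.2 ≠ 0) with hΩ
  have hmem : ∀ i j, (i, j) ∈ Ω ↔ S i j ≠ 0 := fun i j => by simp [hΩ]
  have hΩcard : Ω.card ≤ se := by
    refine le_of_eq_of_le ?_ hS
    rw [numNonzeros, Set.ncard_eq_toFinset_card']
    congr 1
    ext k
    simp [hΩ]
  have hsum : ∀ (X : Matrix d q ℝ) (t : ℝ), (∀ i j, (i, j) ∉ Ω → X i j = 0) →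
      (∀ i j, |X i j| ≤ t) → ∀ i j, |(A * X * B) i j - A i i * X i j * B j j| ≤
      (∑ k ∈ Ω.erase (i, j), if k.2 = j then a else if k.1 = i then αu * γV else a * γV) * t :=
    fun X t hX ht i j => abs_mul_mul_sub_le hαu.le hγV0 (fun _ _ => abs_dictGram_le hU hD)
      (abs_dictGram_self_le hU hD) (fun _ _ => abs_one_sub_le hV) (abs_one_sub_self_le hV) hX ht i j
  have hrow : ∀ (X : Matrix d q ℝ) (t : ℝ), (∀ i j, (i, j) ∉ Ω → X i j = 0) →
      (∀ i j, |X i j| ≤ t) → ∀ i j, |(A * X * B) i j - A i i * X i j * B j j| ≤ c * t := by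
    intro X t hX ht i j
    refine (hsum X t hX ht i j).trans (mul_le_mul_of_nonneg_right ?_ ((abs_nonneg _).trans (ht i j)))
    rw [hcEq]
    exact row_sum_le hΩcard i j ha0 hαu.le hγV0
  have hdiag' : ∀ i j, (i, j) ∈ Ω → αl * (1 - μ) ^ 2 ≤ A i i * B j j := fun i j h =>
    hdiag i j ((hmem i j).1 h)
  set sg : Matrix d q ℝ := Matrix.of fun i j => Real.sign (S i j) with hsg
  obtain ⟨X, hX0, hXb⟩ := exists_mul_mul_eq hrow hdiag' hcβ (lam • sg - Dᵀ * (U * Vᵀ))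
  have hXS : X ∈ supportSpace S := fun i j h => hX0 i j (by simp [hmem, h])
  have hsgle : ∀ i j, |sg i j| ≤ 1 := fun i j => by
    rcases Real.sign_apply_eq (S i j) with h | h | h <;> simp [hsg, h]
  have hξle : ∀ i j, |(Dᵀ * (U * Vᵀ)) i j| ≤ ξ := fun i j => by
    rw [← Matrix.mul_assoc]; exact le_xiE i j
  set β := αl * (1 - μ) ^ 2 - c with hβ
  have hβpos : 0 < β := sub_pos.2 hcβ
  have hXle : ∀ i j, |X i j| ≤ (lam + ξ) / β := by
    intro i j
    rw [le_div_iff₀' hβpos]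
    refine abs_le_of_dominant hrow hdiag' hcβ hX0 (add_nonneg hlam hξ0) ?_ i j
    intro i j h
    rw [hXb i j h, Matrix.sub_apply, Matrix.smul_apply, smul_eq_mul]
    refine (abs_sub _ _).trans (add_le_add ?_ (hξle i j))
    rw [abs_mul, abs_of_nonneg hlam]
    exact mul_le_of_le_one_right hlam (hsgle i j)
  have hΛ : ∀ i j, (Dᵀ * (U * Vᵀ + projPerp U V (D * X))) i j =
      (Dᵀ * (U * Vᵀ)) i j + (A * X * B) i j := fun i j => by
    rw [Matrix.mul_add, transpose_mul_projPerp, Matrix.add_apply]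
  have hoff : ∀ i j, S i j = 0 → |(Dᵀ * (U * Vᵀ + projPerp U V (D * X))) i j| ≤
      ξ + (∑ k ∈ Ω.erase (i, j), if k.2 = j then a else if k.1 = i then αu * γV else a * γV) *
        ((lam + ξ) / β) := by
    intro i j h
    rw [hΛ]
    refine (abs_add_le _ _).trans (add_le_add (hξle i j) ?_)
    have := hsum X _ hX0 hXle i j
    rwa [hXS i j h, mul_zero, zero_mul, sub_zero] at this
  have hdivc : c / β * (lam + ξ) = c * ((lam + ξ) / β) := by ring
  rw [hdivc] at hξ
  have hquot : 0 ≤ (lam + ξ) / β := div_nonneg (add_nonneg hlam hξ0) hβpos.le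
  have hrowc : ∀ i j, (∑ k ∈ Ω.erase (i, j),
      if k.2 = j then a else if k.1 = i then αu * γV else a * γV) ≤ c := fun i j =>
    (row_sum_le hΩcard i j ha0 hαu.le hγV0).trans_eq hcEq.symm
  set F := frob (projPerp U V (D * X)) (projPerp U V (D * X)) with hF
  set K := lam * √se + √(r * αu) * μ with hKdef
  -- Both the weak and the strict bound on $F=\|Q\|_F^2$ come from analysing $F\ge1$: it can happen
  -- only with equality throughout, which needs $\mu=0$ and $K=\sqrt{\alpha_\ell}$.
  have hF1 : 1 ≤ F → F ≤ 1 ∧ μ = 0 ∧ √αl * (1 - μ) ≤ K := by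
    intro h1F
    have hK0 : 0 ≤ K := by positivity
    have hFX : F = lam * frob X sg - frob X (Dᵀ * (U * Vᵀ)) := by
      rw [hF, frob_projPerp_mul_self hU hV, transpose_mul_projPerp, ← frob_smul_right,
        ← frob_sub_right]
      refine Finset.sum_congr rfl fun i _ => Finset.sum_congr rfl fun j _ => ?_
      by_cases h : (i, j) ∈ Ω
      · rw [hXb i j h]
      · rw [hX0 i j h]; simp
    have h1 := abs_frob_le X sg
    have h2 := hproj X hXS
    have h3 : √(frob sg sg) ≤ √se := Real.sqrt_le_sqrt (frob_sign_le hS)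
    have h4 : F ≤ K * √(frob X X) := by
      have h5 := mul_le_mul_of_nonneg_left h3 (Real.sqrt_nonneg (frob X X))
      have h6 := mul_le_mul_of_nonneg_left ((le_abs_self _).trans (h1.trans h5)) hlam
      have h7 := (neg_abs_le _).trans' (neg_le_neg h2)
      rw [hFX, hKdef]
      linarith
    have h5 : (1 - μ ^ 2) * (αl * frob X X) ≤ F :=
      (mul_le_mul_of_nonneg_left (hD.frob_lower X) (by nlinarith)).trans (hperp X hXS)
    have h6 : F ^ 2 ≤ K ^ 2 * frob X X := by
      have := pow_le_pow_left₀ (by linarith) h4 2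
      rwa [mul_pow, Real.sq_sqrt (frob_self_nonneg X)] at this
    have h7 : 0 ≤ (1 - μ ^ 2) * αl := mul_nonneg (by nlinarith) hD.pos.le
    -- $\|X\|_F$ is eliminated between $F\le K\|X\|_F$ and $(1-\mu^2)\alpha_\ell\|X\|_F^2\le F$.
    have h8' : (1 - μ ^ 2) * αl * F ≤ K ^ 2 := by
      have h9 := mul_le_mul_of_nonneg_left h6 h7
      have h10 := mul_le_mul_of_nonneg_left h5 (sq_nonneg K)
      have h11 : (1 - μ ^ 2) * αl * F * F ≤ K ^ 2 * F := by linarith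
      exact le_of_mul_le_mul_right h11 (by linarith)
    have h8 : (1 - μ ^ 2) * αl ≤ K ^ 2 := (le_mul_of_one_le_right h7 h1F).trans h8'
    have h9 : K ^ 2 ≤ αl * (1 - μ) ^ 2 := by
      have := pow_le_pow_left₀ hK0 hK 2
      rwa [mul_pow, Real.sq_sqrt hD.pos.le] at this
    have h10 : μ = 0 := by
      have : αl * ((1 - μ) * (2 * μ)) ≤ 0 := by linarith
      have h11 := nonpos_of_mul_nonpos_right this hD.pos
      have h12 := nonpos_of_mul_nonpos_right h11 (sub_pos.2 hμ1)
      linarith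
    refine ⟨?_, h10, ?_⟩
    · rw [h10] at h8' h9
      have : αl * F ≤ αl * 1 := by linarith
      exact le_of_mul_le_mul_left this hD.pos
    rw [h10] at h8
    refine le_of_sq_le_sq ?_ hK0
    rw [mul_pow, Real.sq_sqrt hD.pos.le, h10]
    linarith
  have hlt : (K < √αl * (1 - μ) ∨ 0 < μ) → F < 1 := by
    intro h
    by_contra hcon
    obtain ⟨-, e1, e2⟩ := hF1 (not_lt.1 hcon)
    rcases h with h | h <;> linarith
  refine ⟨D * X, ?_, hlt, ?_, ?_, ?_⟩
  · rcases le_total F 1 with h | h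
    exacts [h, (hF1 h).1]
  · intro i j h
    rw [hΛ, hXb i j ((hmem i j).2 h)]
    simp [hsg]
  · intro i j h
    exact (hoff i j h).trans ((add_le_add_right
      (mul_le_mul_of_nonneg_right (hrowc i j) hquot) _).trans hξ)
  · intro hlpos i j h
    refine (hoff i j h).trans_lt ?_
    -- Strictness has two sources: for $\xi_e=0$ the bound is $C_e\lambda<\lambda$; for $\xi_e>0$
    -- both coherences are positive and the row sum is strictly below $c$.
    rcases hξ0.eq_or_lt with hz | hpos
    · rw [← hz, zero_add, add_zero]
      have h1 : c * (lam / β) < lam := by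
        have := mul_lt_mul_of_pos_right hC1 hlpos
        rwa [one_mul, div_mul_eq_mul_div, ← mul_div_assoc'] at this
      exact (mul_le_mul_of_nonneg_right (hrowc i j) (div_nonneg hlam hβpos.le)).trans_lt h1
    · obtain ⟨hγUpos, hγVpos⟩ := gamma_pos_of_xiE_pos hU hV hD hpos
      have hapos : 0 < a := by
        have := hD.le
        have := mul_pos hαu hγUpos
        rw [ha]; linarith
      have h1 := row_sum_lt hse hΩcard i j hapos hαu.le hγVpos
      rw [← hcEq] at h1
      have h2 : 0 < (lam + ξ) / β := div_pos (by linarith) hβpos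
      linarith [mul_lt_mul_of_pos_right h1 h2]

end Certificate

end DRPCA

/-! ### The recovery theorem -/

theorem theorem1 {n m f d r se : ℕ} (hdf : d ≤ f) (hse : 0 < se)
    (M L : Matrix (Fin f) (Fin (n * m)) ℝ) (D : Matrix (Fin f) (Fin d) ℝ)
    (S : Matrix (Fin d) (Fin (n * m)) ℝ) (hM : M = L + D * S)
    (hrank : L.rank = r)
    (U : Matrix (Fin f) (Fin r) ℝ) (σ : Fin r → ℝ) (V : Matrix (Fin (n * m)) (Fin r) ℝ)
    (hSVD : IsCompactSVD L U σ V)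
    (αl αu : ℝ) (hD : GeneralizedFrame D αl αu)
    (μ γU γV ξ Ce : ℝ)
    (hμ : μ = incoherence U V D S)
    (hγU : γU = gammaU U D)
    (hγV : γV = gammaV V)
    (hξ : ξ = xiE U V D)
    (hCe : Ce = ceConst αl αu γU γV se d (n * m) μ)
    -- sparsity; there is no upper bound on `se` when `L = 0`
    (hS : numNonzeros S ≤ se)
    (hsmax : r ≠ 0 → (se : ℝ) ≤ (1 - μ) ^ 2 / 2 * ((n * m : ℕ) / r))
    (hαl : αl ≤ 1 / (1 - μ) ^ 2)
    (hγ : γU ≤ if se ≤ d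
      then ((1 - μ) ^ 2 - 2 * se * γV) / (2 * se * (1 + γV))
      else ((1 - μ) ^ 2 - 2 * se * γV) / (2 * (d + se * γV)))
    -- `C_e` is well defined and `0 ≤ C_e < 1`
    (hden : ceDenom αl αu γU γV se d (n * m) μ ≠ 0)
    (hCe0 : 0 ≤ Ce) (hCe1 : Ce < 1)
    (hint : lamMin Ce ξ < lamMax αl αu μ r se) :
    ∀ lam ∈ Set.Icc (lamMin Ce ξ) (lamMax αl αu μ r se),
      (L, S) ∈ solutions D M lam ∧
      (lam ≠ lamMax αl αu μ r se ∨ μ ≠ 0 → solutions D M lam = {(L, S)}) := by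
  rintro lam ⟨hl, hu⟩
  have hμ0 : 0 ≤ μ := hμ ▸ incoherence_nonneg
  have hξ0 : 0 ≤ ξ := hξ ▸ xiE_nonneg
  have hmin : ξ ≤ lamMin Ce ξ := by
    refine le_mul_of_one_le_left hξ0 ?_
    rw [one_le_div (sub_pos.2 hCe1)]
    linarith
  have hlam : 0 ≤ lam := hξ0.trans (hmin.trans hl)
  have hse' : (0 : ℝ) < √(se : ℝ) := Real.sqrt_pos.2 (by exact_mod_cast hse)
  have hαl' : 0 < √αl := Real.sqrt_pos.2 hD.pos
  -- The interval condition makes $\lambda_e^{\max}$ positive, which already forces $\mu<1$.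
  have hμ1 : μ < 1 := by
    have h1 : 0 < lamMax αl αu μ r se := (hξ0.trans hmin).trans_lt hint
    have h2 : 0 < √αl * (1 - μ) - √(r * αu) * μ := by
      by_contra h
      exact absurd h1 (not_lt.2 (div_nonpos_of_nonpos_of_nonneg (not_lt.1 h) hse'.le))
    have h3 : 0 < √αl * (1 - μ) := by
      linarith [mul_nonneg (Real.sqrt_nonneg (r * αu)) hμ0]
    linarith [(mul_pos_iff_of_pos_left hαl').1 h3]
  set c := cConst αl αu γU γV se d (n * m) with hc
  have hpos : 0 < αl * (1 - μ) ^ 2 := mul_pos hD.pos (pow_pos (sub_pos.2 hμ1) 2)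
  have hCeq : Ce = c / (αl * (1 - μ) ^ 2 - c) := hCe
  -- A negative denominator would mean $c>\alpha_\ell(1-\mu)^2>0$, hence $C_e<0$.
  have hβ : 0 < αl * (1 - μ) ^ 2 - c := by
    refine lt_of_le_of_ne (not_lt.1 fun h => ?_) (Ne.symm hden)
    have h1 : Ce < 0 := by
      rw [hCeq]
      exact div_neg_of_pos_of_neg (by linarith) h
    linarith
  have hK : lam * √(se : ℝ) + √(r * αu) * μ ≤ √αl * (1 - μ) := by
    rw [lamMax, le_div_iff₀ hse'] at hu
    linarith
  have hK' : lam ≠ lamMax αl αu μ r se →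
      lam * √(se : ℝ) + √(r * αu) * μ < √αl * (1 - μ) := by
    intro hne
    have hx := lt_of_le_of_ne hu hne
    rw [lamMax, lt_div_iff₀ hse'] at hx
    linarith
  have hoff : ξ + Ce * (lam + ξ) ≤ lam := by
    rw [lamMin, div_mul_eq_mul_div, div_le_iff₀ (sub_pos.2 hCe1)] at hl
    linarith
  rw [hCeq] at hoff hCe1
  subst hμ hγU hγV hξ
  obtain ⟨Q, hQ1, hQlt, hon, hle, hlt⟩ := exists_certificate hSVD.orthU hSVD.orthV hD hse hS hμ1
    (by simpa using hc) (sub_pos.1 hβ) hlam hCe1 hK hoff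
  have hfeas : ∀ x ∈ feasible D M, x = (L - D * (x.2 - S), S + (x.2 - S)) := by
    rintro ⟨X, Y⟩ h
    have h : M = X + D * Y := h
    refine Prod.ext ?_ ?_
    · simp only [Matrix.mul_sub]
      have : X = M - D * Y := by rw [h]; simp
      rw [this, hM]
      abel
    · simp
  have hsol : (L, S) ∈ solutions D M lam := by
    refine ⟨hM, fun x hx => ?_⟩
    have h1 := objective_le_of_certificate hSVD hQ1 hlam hon hle (x.2 - S)
    rw [← hfeas x hx] at h1
    exact h1
  refine ⟨hsol, fun hne => ?_⟩
  rw [Set.eq_singleton_iff_unique_mem]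
  refine ⟨hsol, fun x hx => ?_⟩
  have hxe := hfeas x hx.1
  have hobj : objective lam (L - D * (x.2 - S), S + (x.2 - S)) ≤ objective lam (L, S) := by
    rw [← hxe]
    exact hx.2 hsol.1
  set H := x.2 - S with hH
  have hDH : D * H = 0 → x = (L, S) := by
    intro h0
    have h1 := hD.frob_lower H
    rw [h0] at h1
    have h2 : frob H H = 0 := by
      refine le_antisymm ?_ (frob_self_nonneg H)
      by_contra h
      have := mul_pos hD.pos (not_le.1 h)
      simp only [frob, Matrix.zero_apply, mul_zero, Finset.sum_const_zero] at h1 this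
      linarith
    rw [hxe, frob_self_eq_zero h2]
    simp
  refine hDH ?_
  -- When $\lambda=0$, $\xi_e\le\lambda_e^{\min}\le\lambda$ gives $D^\top UV^\top=0$; multiplying by
  -- $V$ shows that the columns of $D$ are orthogonal to those of $U$.
  rcases hlam.eq_or_lt with h0 | hlpos
  · have hξz : xiE U V D = 0 := le_antisymm (h0 ▸ hmin.trans hl) hξ0
    have hz : Dᵀ * U * Vᵀ = 0 := by
      ext i j
      simpa [hξz] using le_xiE (U := U) (V := V) (D := D) i j
    have hz' : Uᵀ * D = 0 := by
      have h1 : Dᵀ * U = 0 := by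
        rw [← Matrix.mul_one (Dᵀ * U), ← hSVD.orthV, ← Matrix.mul_assoc, hz, Matrix.zero_mul]
      simpa using congrArg Matrix.transpose h1
    refine eq_zero_of_nuclearNorm_sub_le hSVD ?_ ?_
    · rw [← Matrix.mul_assoc, hz', Matrix.zero_mul]
    · simpa [objective, ← h0] using hobj
  · have hQ : frob (projPerp U V Q) (projPerp U V Q) < 1 :=
      hQlt (hne.imp hK' fun h => lt_of_le_of_ne hμ0 h.symm)
    obtain ⟨hp, hs⟩ := of_objective_le_of_certificate hSVD hQ hlam hon (hlt hlpos) hobj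
    have h1 := le_frob_projPerp hSVD.orthU hSVD.orthV (D := D) (S := S) ⟨H, hs, rfl⟩
    rw [hp] at h1
    have h2 : frob (0 : Matrix (Fin f) (Fin (n * m)) ℝ) 0 = 0 := by simp [frob]
    rw [h2] at h1
    refine frob_self_eq_zero (le_antisymm ?_ (frob_self_nonneg _))
    refine nonpos_of_mul_nonpos_right h1 ?_
    nlinarith
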